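/- Let $\mathbb K$ be a field, $F=\mathbb K\langle x_1,\dots,x_n\rangle$ the free associative algebra with its standard grading, $I\subset F$ a graded two-sided ideal and $A=F/I$. Let $P=\mathbb K[x_{ij}\mid 1\le i\le n,\ j\ge 1]$, $R=P/\langle x_{ij}x_{kj}\mid 1\le i,k\le n,\ j\ge1\rangle$, let $\sigma:R\to R$ be the algebra endomorphism $x_{ij}\mapsto x_{i\,j+1}$ and $\iota:F\to R$ the $\mathbb K$-linear map $x_{i_1}\cdots x_{i_m}\mapsto x_{i_11}\cdots x_{i_mm}$. Let $J\subset R$ be the ideal generated by $\bigcup_{k\ge0}\sigma^k(\iota(I))$ and $S=R/J$; denote again by $\sigma:S\to S$ and $\iota:A\to S$ the induced maps. For $d\ge 0$ let $S(d)\subset S$ be the subalgebra generated by the $x_{ij}$ with $j\le d$. For integers $\delta_1,\dots,\delta_m\ge0$ let $\iota:\bigoplus_i A[-\delta_i]\to\bigoplus_i S[-\delta_i]$ be the map $\sum_i e_if_i\mapsto\sum_i e'_i\,\sigma^{\delta_i}(\iota(f_i))$, where $e_i$ and $e'_i$ are the canonical basis elements, of degree $\delta_i$. A minimal basis of a graded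 (right) module is a homogeneous generating set in which no element is generated by the other ones. Let $M\subset A^r$ be a graded right submodule with a finite minimal basis $\{g_1,\dots,g_s\}$ (the $g_j$ distinct), $\Delta_j=\deg g_j$ and $g'_j=\iota(g_j)\in S^r$. Let $$K=\Big\{\sum_j\epsilon_jf_j\ \Big|\ f_j\in A,\ \sum_jg_jf_j=0\Big\}\subset\bigoplus_jA[-\Delta_j],\qquad K'=\Big\{\sum_j\epsilon'_jf'_j\ \Big|\ f'_j\in S,\ \sum_jg'_jf'_j=0\Big\}\subset\bigoplus_jS[-\Delta_j],$$ where $\epsilon_j$ and $\epsilon'_j$ are the canonical basis elements, of degree $\Delta_j$. Let $L(M)\subset S^r$ be the $S$-submodule generated by $\iota(M)$. Let $d\ge0$ be such that $L(M)$ is generated by $L(M)\cap S(d)^r$, let $K'_{|d}=K'\cap\bigoplus_jS(d)[-\Delta_j]$, regarded as a graded module over $S(d)$, and let $B=\{\epsilon'_jx_{kl}\mid 1\le j\le s,\ 1\le k\le n,\ 1\le l\le\Delta_j\}$. Proposition 9.1. Let $B\cup\{h'_k\}$ be a minimal basis of the $S(d)$-module $K'_{|d}$. Then the $h'_k$ can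 be chosen in the image of $\iota:\bigoplus_jA[-\Delta_j]\to\bigoplus_jS[-\Delta_j]$; that is, there is a set $H''$ contained in this image such that $B\cup H''$ is also a minimal basis of $K'_{|d}$. Moreover, if all the $h'_k$ lie in the image of $\iota$, then $\iota^{-1}(\{h'_k\})$ is a minimal basis of $K$ in all degrees $\le d$: it consists of homogeneous elements of $K$ of degree $\le d$, it generates every homogeneous element of $K$ of degree $\le d$, and none of its elements is generated by the other ones. -/

import Mathlib

noncomputable section

namespace Letterplace

section General

/-- A vector `f` of the free module `⨁ i, T[-δ i]` is homogeneous of degree `d` when each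
coordinate `f i` is homogeneous of degree `d - δ i` (and is zero if `d < δ i`). Here `𝒯 e` is
the homogeneous component of degree `e` of the graded algebra `T`. -/
def IsHomogeneousVec {𝕂 T : Type*} [Field 𝕂] [Ring T] [Algebra 𝕂 T] (𝒯 : ℕ → Submodule 𝕂 T)
    {s : ℕ} (δ : Fin s → ℕ) (d : ℕ) (f : Fin s → T) : Prop :=
  ∀ i, f i = 0 ∨ ∃ e, δ i + e = d ∧ f i ∈ 𝒯 e

/-- `X` is a minimal (homogeneous) basis of the submodule `N`: it consists of homogeneous elements,
it generates `N`, and no element of `X` is generated by the other ones.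
`hom d x` says that `x` is homogeneous of degree `d`. -/
structure IsMinimalBasis {T E : Type*} [Ring T] [AddCommGroup E] [Module T E]
    (hom : ℕ → E → Prop) (N : Submodule T E) (X : Set E) : Prop where
  homogeneous : ∀ x ∈ X, ∃ d, hom d x
  span_eq : Submodule.span T X = N
  irredundant : ∀ x ∈ X, x ∉ Submodule.span T (X \ {x})

/-- `X` is a minimal (homogeneous) basis of the graded submodule `N` in all degrees `≤ d`:
it consists of homogeneous elements of `N` of degree `≤ d`, every homogeneous element of `N` of
degree `≤ d` is generated by `X`, and no element of `X` is generated by the other ones. -/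
structure IsMinimalBasisUpTo {T E : Type*} [Ring T] [AddCommGroup E] [Module T E]
    (hom : ℕ → E → Prop) (N : Submodule T E) (d : ℕ) (X : Set E) : Prop where
  subset : ∀ x ∈ X, x ∈ N
  homogeneous : ∀ x ∈ X, ∃ e ≤ d, hom e x
  generates : ∀ e ≤ d, ∀ x ∈ N, hom e x → x ∈ Submodule.span T X
  irredundant : ∀ x ∈ X, x ∉ Submodule.span T (X \ {x})

end General

section FreeSide

variable (𝕂 : Type*) [Field 𝕂] (n : ℕ)

/-- The free associative algebra `F = 𝕂⟨x₁, …, xₙ⟩`. -/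
abbrev F : Type _ := FreeAlgebra 𝕂 (Fin n)

/-- The component `F_d`, spanned by the words of length `d`. -/
def compF (d : ℕ) : Submodule 𝕂 (F 𝕂 n) :=
  Submodule.span 𝕂 (FreeAlgebra.basisFreeMonoid 𝕂 (Fin n) '' {w | w.toList.length = d})

variable {𝕂 n}

/-- The ideal `I` is graded: `I = ∑ d, I ∩ F_d`. -/
def IsGradedIdeal (I : Ideal (F 𝕂 n)) : Prop :=
  I.restrictScalars 𝕂 = ⨆ d, I.restrictScalars 𝕂 ⊓ compF 𝕂 n d

/-- The algebra `A = F / I`. -/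
abbrev A (I : Ideal (F 𝕂 n)) : Type _ := F 𝕂 n ⧸ I

/-- The component `A_d`, the image of `F_d`. -/
def compA (I : Ideal (F 𝕂 n)) [I.IsTwoSided] (d : ℕ) : Submodule 𝕂 (A I) :=
  (compF 𝕂 n d).map (Ideal.Quotient.mkₐ 𝕂 I).toLinearMap

/-- The homomorphism of right `A`-modules `φ : ⨁ j, A[-Δ j] → A^r`, `ε_j ↦ g j`, that is,
`∑ j, ε_j f_j ↦ ∑ j, g_j f_j`. Right `A`-modules are modules over the opposite ring. -/
def phi (I : Ideal (F 𝕂 n)) [I.IsTwoSided] {r s : ℕ} (g : Fin s → Fin r → A I) :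
    (Fin s → A I) →ₗ[(A I)ᵐᵒᵖ] (Fin r → A I) where
  toFun f := fun i => ∑ j, g j i * f j
  map_add' f f' := by
    funext i
    simp [mul_add, Finset.sum_add_distrib]
  map_smul' a f := by
    funext i
    simp [Finset.sum_mul, mul_assoc]

/-- The right syzygy module `K = Ker φ` of `{g_j}`. -/
def K (I : Ideal (F 𝕂 n)) [I.IsTwoSided] {r s : ℕ} (g : Fin s → Fin r → A I) :
    Submodule (A I)ᵐᵒᵖ (Fin s → A I) :=
  LinearMap.ker (phi I g)

end FreeSide

section CommutativeSide

variable (𝕂 : Type*) [Field 𝕂] (n : ℕ)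

/-- The polynomial algebra `P` in the letterplace variables. Letters are indexed by `Fin n` and
places by `ℕ`, counted from `0`: the variable `(i, l)` is the one usually written
`x_{i+1, l+1}`. -/
abbrev P : Type _ := MvPolynomial (Fin n × ℕ) 𝕂

/-- The monomial ideal `Q` generated by all products of two variables with the same place. -/
def Q : Ideal (P 𝕂 n) :=
  Ideal.span {p | ∃ (i k : Fin n) (l : ℕ),
    p = MvPolynomial.X (i, l) * MvPolynomial.X (k, l)}

/-- The algebra `R = P / Q`. -/
def R : Type _ := P 𝕂 n ⧸ Q 𝕂 n

instance : CommRing (R 𝕂 n) := inferInstanceAs (CommRing (P 𝕂 n ⧸ Q 𝕂 n))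

instance : Algebra 𝕂 (R 𝕂 n) := inferInstanceAs (Algebra 𝕂 (P 𝕂 n ⧸ Q 𝕂 n))

/-- The canonical projection `P → R`. -/
def mkR : P 𝕂 n →ₐ[𝕂] R 𝕂 n := Ideal.Quotient.mkₐ 𝕂 (Q 𝕂 n)

/-- The shift of the places by one, on `P`. -/
def sigmaP : P 𝕂 n →ₐ[𝕂] P 𝕂 n := MvPolynomial.rename fun p => (p.1, p.2 + 1)

theorem Q_le_comap_sigmaP : Q 𝕂 n ≤ (Q 𝕂 n).comap (sigmaP 𝕂 n) := by
  refine Ideal.span_le.2 ?_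
  rintro _ ⟨i, k, l, rfl⟩
  refine Ideal.subset_span ⟨i, k, l + 1, ?_⟩
  simp [sigmaP]

/-- The algebra endomorphism `σ` of `R`, mapping the variable `(i, l)` to `(i, l + 1)`. -/
def sigmaR : R 𝕂 n →ₐ[𝕂] R 𝕂 n :=
  Ideal.quotientMapₐ (Q 𝕂 n) (sigmaP 𝕂 n) (Q_le_comap_sigmaP 𝕂 n)

/-- The `𝕂`-linear map `ι : F → R` which puts the letters of a word in consecutive places,
starting from the first one. -/
def iotaF : F 𝕂 n →ₗ[𝕂] R 𝕂 n :=
  (FreeAlgebra.basisFreeMonoid 𝕂 (Fin n)).constr 𝕂 fun w =>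
    ∏ l : Fin w.toList.length,
      mkR 𝕂 n (MvPolynomial.X (w.toList.get l, (l : ℕ)))

variable {𝕂 n}

/-- The letterplace analogue `J = L(I)`: the ideal of `R` generated by all
`σ^k (ι f)` with `f ∈ I` and `k ≥ 0`. -/
def J (I : Ideal (F 𝕂 n)) : Ideal (R 𝕂 n) :=
  Ideal.span {y | ∃ (k : ℕ) (f : F 𝕂 n), f ∈ I ∧ y = (sigmaR 𝕂 n)^[k] (iotaF 𝕂 n f)}

/-- The algebra `S = R / J`. -/
def S (I : Ideal (F 𝕂 n)) : Type _ := R 𝕂 n ⧸ J I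

instance (I : Ideal (F 𝕂 n)) : CommRing (S I) := inferInstanceAs (CommRing (R 𝕂 n ⧸ J I))

instance (I : Ideal (F 𝕂 n)) : Algebra 𝕂 (S I) := inferInstanceAs (Algebra 𝕂 (R 𝕂 n ⧸ J I))

/-- The canonical projection `R → S`. -/
def mkS (I : Ideal (F 𝕂 n)) : R 𝕂 n →ₐ[𝕂] S I := Ideal.Quotient.mkₐ 𝕂 (J I)

theorem J_le_comap_sigmaR (I : Ideal (F 𝕂 n)) : J I ≤ (J I).comap (sigmaR 𝕂 n) := by
  refine Ideal.span_le.2 ?_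
  rintro _ ⟨k, f, hf, rfl⟩
  exact Ideal.subset_span ⟨k + 1, f, hf, (Function.iterate_succ_apply' _ _ _).symm⟩

/-- The algebra endomorphism of `S` induced by `σ`. -/
def sigma (I : Ideal (F 𝕂 n)) : S I →ₐ[𝕂] S I :=
  Ideal.quotientMapₐ (J I) (sigmaR 𝕂 n) (J_le_comap_sigmaR I)

theorem iotaF_mem (I : Ideal (F 𝕂 n)) :
    I.restrictScalars 𝕂 ≤
      LinearMap.ker ((mkS I).toLinearMap ∘ₗ iotaF 𝕂 n) := by
  intro f hf
  rw [LinearMap.mem_ker]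
  exact Ideal.Quotient.eq_zero_iff_mem.2 (Ideal.subset_span ⟨0, f, hf, rfl⟩)

/-- The `𝕂`-linear map `ι : A → S` induced by `ι : F → R`. -/
def iotaA (I : Ideal (F 𝕂 n)) [I.IsTwoSided] : A I →ₗ[𝕂] S I :=
  (I.restrictScalars 𝕂).liftQ _ (iotaF_mem I) ∘ₗ
    (Submodule.Quotient.restrictScalarsEquiv 𝕂 I).symm.toLinearMap

/-- The module letterplace embedding `ι : ⨁ j, A[-δ j] → ⨁ j, S[-δ j]`,
`e_j f ↦ e'_j σ^(δ j) (ι f)`. -/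
def iota (I : Ideal (F 𝕂 n)) [I.IsTwoSided] {s : ℕ} (δ : Fin s → ℕ) (f : Fin s → A I) :
    Fin s → S I :=
  fun j => (sigma I)^[δ j] (iotaA I (f j))

/-- The coset in `S` of the variable `(i, l)`. -/
def x (I : Ideal (F 𝕂 n)) (i : Fin n) (l : ℕ) : S I :=
  mkS I (mkR 𝕂 n (MvPolynomial.X (i, l)))

/-- The component `S_d`, the image of the homogeneous polynomials of degree `d`. -/
def compS (I : Ideal (F 𝕂 n)) (d : ℕ) : Submodule 𝕂 (S I) :=
  (MvPolynomial.homogeneousSubmodule (Fin n × ℕ) 𝕂 d).map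
    ((mkS I).comp (mkR 𝕂 n)).toLinearMap

/-- The finitely generated algebra `S(d) = R(d) / (J ∩ R(d))`, as the subalgebra of `S` generated
by the variables in the first `d` places. -/
def Strunc (I : Ideal (F 𝕂 n)) (d : ℕ) : Subalgebra 𝕂 (S I) :=
  Algebra.adjoin 𝕂 {y | ∃ (i : Fin n) (l : ℕ), l < d ∧ y = x I i l}

/-- The letterplace analogue `L(M)` of a right submodule `M` of `A^r`: the `S`-submodule of `S^r`
generated by `ι(M)`. -/
def L (I : Ideal (F 𝕂 n)) [I.IsTwoSided] {r : ℕ} (M : Submodule (A I)ᵐᵒᵖ (Fin r → A I)) :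
    Submodule (S I) (Fin r → S I) :=
  Submodule.span (S I) (iota I (fun _ => 0) '' M)

/-- The set `M'(d) = M' ∩ S(d)^r`. -/
def truncSet (I : Ideal (F 𝕂 n)) {r : ℕ} (M' : Submodule (S I) (Fin r → S I)) (d : ℕ) :
    Set (Fin r → S I) :=
  {m | m ∈ M' ∧ ∀ i, m i ∈ Strunc I d}

/-- The homomorphism of `S`-modules `φ' : ⨁ j, S[-Δ j] → S^r`, `ε'_j ↦ g' j`. -/
def phi' (I : Ideal (F 𝕂 n)) {r s : ℕ} (g' : Fin s → Fin r → S I) :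
    (Fin s → S I) →ₗ[S I] (Fin r → S I) :=
  Fintype.linearCombination (S I) g'

/-- The syzygy module `K' = Ker φ'` of `{g'_j}`. -/
def K' (I : Ideal (F 𝕂 n)) {r s : ℕ} (g' : Fin s → Fin r → S I) :
    Submodule (S I) (Fin s → S I) :=
  LinearMap.ker (phi' I g')

/-- The truncated syzygy module `K' ∩ ⨁ j, S(d)[-Δ j]`, as a module over `S(d)`. -/
def Ktrunc (I : Ideal (F 𝕂 n)) {r s : ℕ} (g' : Fin s → Fin r → S I) (d : ℕ) :
    Submodule (Strunc I d) (Fin s → S I) where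
  carrier := {f | f ∈ K' I g' ∧ ∀ j, f j ∈ Strunc I d}
  add_mem' hf hf' := ⟨add_mem hf.1 hf'.1, fun j => add_mem (hf.2 j) (hf'.2 j)⟩
  zero_mem' := ⟨zero_mem _, fun _ => zero_mem _⟩
  smul_mem' a _ hf := ⟨(K' I g').smul_mem (a : S I) hf.1, fun j => mul_mem a.2 (hf.2 j)⟩

/-- The monomial basis `B = {ε'_j x_{k l} | the place l is one of the first Δ j places}` of the
submodule `C` of trivial syzygies. -/
def B (I : Ideal (F 𝕂 n)) {s : ℕ} (Δ : Fin s → ℕ) : Set (Fin s → S I) :=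
  {b | ∃ (j : Fin s) (k : Fin n) (l : ℕ), l < Δ j ∧ b = Pi.single j (x I k l)}

end CommutativeSide

end Letterplace

end

/-! The argument rests on the multigrading of `S` by places. Give `ε'_j` the multidegree of the
interval `[0, Δ_j)`, which is that of `g'_j`; every syzygy in `K'` is then a sum of multihomogeneous
ones. Fix a multidegree `U`. If `U` is at least 2 at some place `l`, each component either vanishes,
two letters sharing `l`, or is a combination of monomials with a variable at `l < Δ_j`, and so comes
from `B`. Otherwise let `m` be the first empty place of `U`: each nonzero component is a combination
of products of a word filling `[Δ_j, m)` and a monomial at places after `m`. No relation of `S`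
crosses an empty place, so `split` separates the two factors; expanding the second in a basis of `S`
writes the syzygy as a combination of vectors `ι f`, with `f` a homogeneous syzygy over `A` of
degree `m`. Thus `B` and the images of homogeneous elements of `K` generate `K'` (`K'_le_span`).

Minimality of the `g_j` forbids nonzero scalar components in syzygies, so a nonzero component of an
image of degree `m` fills the nonempty interval `[Δ_j, m)`. Killing the places from `d` on therefore
erases the images of degree above `d`, which gives generators over `S(d)` (`Ktrunc_le_span`).
Keeping only the places below `Δ_j` in coordinate `j` erases every image, so images never help to
generate elements of `B` (`B_irredundant`). Since `S(d)` is Noetherian, an irredundant choice of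
images exists.

For the preimage, `collapse : S → A` reads letters in the order of their places. After the places
before `Δ_j` are deleted in coordinate `j`, it kills `B`, inverts `ι`, and turns `S`-combinations of
images into right `A`-combinations (`mem_span_preimage`); `iota_mem_span` goes the other way.

These maps on `S` exist because `I` is graded: `J` is generated by elements whose monomials all
occupy one and the same interval of places. -/

noncomputable section

namespace Letterplace

variable {𝕂 : Type*} [Field 𝕂] {n : ℕ}

/-! ### Words in the free algebra and in `A` -/

section Words

variable (𝕂) in
/-- The word `w` as an element of the free algebra. -/
def word (w : List (Fin n)) : F 𝕂 n := (w.map (FreeAlgebra.ι 𝕂)).prod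

theorem basisFreeMonoid_eq_word (w : FreeMonoid (Fin n)) :
    FreeAlgebra.basisFreeMonoid 𝕂 (Fin n) w = word 𝕂 w.toList := by
  rw [word, ← FreeMonoid.lift_apply]
  simp [FreeAlgebra.basisFreeMonoid, FreeAlgebra.equivMonoidAlgebraFreeMonoid,
    MonoidAlgebra.lift_single]

@[simp] theorem word_nil : word 𝕂 ([] : List (Fin n)) = 1 := by simp [word]

@[simp] theorem word_cons (a : Fin n) (w : List (Fin n)) :
    word 𝕂 (a :: w) = FreeAlgebra.ι 𝕂 a * word 𝕂 w := by simp [word]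

theorem word_append (u w : List (Fin n)) : word 𝕂 (u ++ w) = word 𝕂 u * word 𝕂 w := by
  simp [word]

theorem compF_eq_span (d : ℕ) :
    compF 𝕂 n d = Submodule.span 𝕂 (word 𝕂 '' {w | w.length = d}) := by
  rw [compF]
  congr 1
  ext f
  constructor
  · rintro ⟨w, hw, rfl⟩
    exact ⟨w.toList, hw, (basisFreeMonoid_eq_word w).symm⟩
  · rintro ⟨w, hw, rfl⟩
    exact ⟨FreeMonoid.ofList w, hw, basisFreeMonoid_eq_word _⟩

theorem span_word_eq_top : Submodule.span 𝕂 (Set.range (word 𝕂 (n := n))) = ⊤ := by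
  rw [eq_top_iff, ← (FreeAlgebra.basisFreeMonoid 𝕂 (Fin n)).span_eq]
  refine Submodule.span_mono ?_
  rintro _ ⟨w, rfl⟩
  exact ⟨w.toList, (basisFreeMonoid_eq_word w).symm⟩

variable (I : Ideal (F 𝕂 n)) [I.IsTwoSided]

/-- The class in `A` of the word `w`. -/
def wordA (w : List (Fin n)) : A I := Ideal.Quotient.mkₐ 𝕂 I (word 𝕂 w)

@[simp] theorem wordA_nil : wordA I ([] : List (Fin n)) = 1 := by
  rw [wordA, word_nil, map_one]

theorem wordA_append (u w : List (Fin n)) : wordA I (u ++ w) = wordA I u * wordA I w := by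
  rw [wordA, word_append, map_mul]; rfl

theorem wordA_cons (a : Fin n) (w : List (Fin n)) :
    wordA I (a :: w) = wordA I [a] * wordA I w := wordA_append I [a] w

theorem compA_eq_span (d : ℕ) :
    compA I d = Submodule.span 𝕂 (wordA I '' {w | w.length = d}) := by
  rw [compA, compF_eq_span, Submodule.map_span, ← Set.image_comp]
  rfl

theorem span_wordA_eq_top : Submodule.span 𝕂 (Set.range (wordA I)) = ⊤ := by
  have h := congrArg (Submodule.map (Ideal.Quotient.mkₐ 𝕂 I).toLinearMap)
    (span_word_eq_top (𝕂 := 𝕂) (n := n))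
  rw [Submodule.map_span, ← Set.range_comp, Submodule.map_top, LinearMap.range_eq_top.2] at h
  · exact h
  · exact Ideal.Quotient.mkₐ_surjective 𝕂 I

theorem wordA_mem_compA (w : List (Fin n)) : wordA I w ∈ compA I w.length := by
  rw [compA_eq_span]
  exact Submodule.subset_span ⟨w, rfl, rfl⟩

theorem one_mem_compA : (1 : A I) ∈ compA I 0 := by
  simpa using wordA_mem_compA I ([] : List (Fin n))

variable {I} in
theorem mul_mem_compA {d e : ℕ} {a b : A I} (ha : a ∈ compA I d) (hb : b ∈ compA I e) :
    a * b ∈ compA I (d + e) := by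
  rw [compA_eq_span] at ha hb
  induction ha using Submodule.span_induction with
  | mem a ha =>
    obtain ⟨u, rfl, rfl⟩ := ha
    induction hb using Submodule.span_induction with
    | mem b hb =>
      obtain ⟨w, rfl, rfl⟩ := hb
      rw [← wordA_append, ← List.length_append]
      exact wordA_mem_compA I _
    | zero => rw [mul_zero]; exact zero_mem _
    | add x y _ _ hx hy => rw [mul_add]; exact add_mem hx hy
    | smul c x _ hx => rw [mul_smul_comm]; exact Submodule.smul_mem _ _ hx
  | zero => rw [zero_mul]; exact zero_mem _
  | add x y _ _ hx hy => rw [add_mul]; exact add_mem hx hy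
  | smul c x _ hx => rw [smul_mul_assoc]; exact Submodule.smul_mem _ _ hx

end Words

/-! ### Letterplace monomials and their multidegree by places -/

section Monomials

/-- The exponent of the monomial which puts the letters of the word `w` in consecutive places,
starting from the place `k`. -/
def wordExp : ℕ → List (Fin n) → (Fin n × ℕ →₀ ℕ)
  | _, [] => 0
  | k, a :: w => Finsupp.single (a, k) 1 + wordExp (k + 1) w

@[simp] theorem wordExp_nil (k : ℕ) : wordExp k ([] : List (Fin n)) = 0 := rfl

@[simp] theorem wordExp_cons (k : ℕ) (a : Fin n) (w : List (Fin n)) :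
    wordExp k (a :: w) = Finsupp.single (a, k) 1 + wordExp (k + 1) w := rfl

theorem wordExp_append (k : ℕ) (u w : List (Fin n)) :
    wordExp k (u ++ w) = wordExp k u + wordExp (k + u.length) w := by
  induction u generalizing k with
  | nil => simp
  | cons a u ih => simp [ih, add_assoc, add_comm 1]

/-- The multidegree of a monomial with respect to the places. -/
def place (s : Fin n × ℕ →₀ ℕ) : ℕ →₀ ℕ := s.mapDomain Prod.snd

/-- The indicator function of the interval `[k, k + e)`. -/
def interval : ℕ → ℕ → (ℕ →₀ ℕ)
  | _, 0 => 0
  | k, e + 1 => Finsupp.single k 1 + interval (k + 1) e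

@[simp] theorem interval_zero (k : ℕ) : interval k 0 = 0 := rfl

theorem interval_succ (k e : ℕ) :
    interval k (e + 1) = Finsupp.single k 1 + interval (k + 1) e := rfl

theorem interval_apply (k e l : ℕ) :
    interval k e l = if k ≤ l ∧ l < k + e then 1 else 0 := by
  induction e generalizing k with
  | zero => rw [if_neg (by omega)]; rfl
  | succ e ih =>
    rw [interval_succ, Finsupp.add_apply, ih, Finsupp.single_apply]
    split_ifs <;> omega

theorem interval_add (k e e' : ℕ) :
    interval k (e + e') = interval k e + interval (k + e) e' := by
  ext l
  simp only [Finsupp.add_apply, interval_apply]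
  split_ifs <;> omega

@[simp] theorem place_zero : place (0 : Fin n × ℕ →₀ ℕ) = 0 := Finsupp.mapDomain_zero

theorem place_add (s t : Fin n × ℕ →₀ ℕ) : place (s + t) = place s + place t :=
  Finsupp.mapDomain_add

@[simp] theorem place_single (p : Fin n × ℕ) (e : ℕ) :
    place (Finsupp.single p e) = Finsupp.single p.2 e := Finsupp.mapDomain_single

theorem place_wordExp (k : ℕ) (w : List (Fin n)) :
    place (wordExp k w) = interval k w.length := by
  induction w generalizing k with
  | nil => simp
  | cons a w ih => rw [wordExp_cons, place_add, ih]; simp [interval_succ]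

theorem exists_eq_single_add {s : Fin n × ℕ →₀ ℕ} {l : ℕ} (h : place s l ≠ 0) :
    ∃ (k : Fin n) (t : Fin n × ℕ →₀ ℕ), s = Finsupp.single (k, l) 1 + t := by
  classical
  have hl : l ∈ (s.mapDomain Prod.snd).support := Finsupp.mem_support_iff.2 h
  obtain ⟨⟨k, l'⟩, hp, rfl⟩ := Finset.mem_image.1 (Finsupp.mapDomain_support hl)
  refine ⟨k, s - Finsupp.single (k, l') 1, (add_tsub_cancel_of_le ?_).symm⟩
  rw [Finsupp.single_le_iff]
  exact Nat.one_le_iff_ne_zero.2 (Finsupp.mem_support_iff.1 hp)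

theorem le_place (s : Fin n × ℕ →₀ ℕ) (p : Fin n × ℕ) : s p ≤ place s p.2 := by
  obtain ⟨t, ht⟩ := exists_add_of_le
    (Finsupp.single_le_iff.2 le_rfl : Finsupp.single p (s p) ≤ s)
  conv_rhs => rw [ht, place_add, place_single, Finsupp.add_apply, Finsupp.single_eq_same]
  exact Nat.le_add_right _ _

/-- A monomial whose multidegree contains an interval starts, up to reordering, with a word placed
in that interval. -/
theorem exists_eq_wordExp_add (e k : ℕ) (V : ℕ →₀ ℕ) (s : Fin n × ℕ →₀ ℕ)
    (h : place s = interval k e + V) :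
    ∃ (w : List (Fin n)) (t : Fin n × ℕ →₀ ℕ),
      w.length = e ∧ place t = V ∧ s = wordExp k w + t := by
  induction e generalizing k s with
  | zero => exact ⟨[], s, rfl, by simpa using h, by simp⟩
  | succ e ih =>
    obtain ⟨a, t, rfl⟩ := exists_eq_single_add (s := s) (l := k) (by
      rw [h, Finsupp.add_apply, interval_apply, if_pos (by omega)]; omega)
    rw [place_add, place_single, interval_succ, add_assoc] at h
    obtain ⟨w, t, rfl, ht, rfl⟩ := ih (k + 1) t (add_left_cancel h)
    exact ⟨a :: w, t, rfl, ht, by rw [wordExp_cons, add_assoc]⟩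

variable (I : Ideal (F 𝕂 n))

/-- The class in `S` of the monomial with exponent `s`. -/
def mono (s : Fin n × ℕ →₀ ℕ) : S I := mkS I (mkR 𝕂 n (MvPolynomial.monomial s 1))

@[simp] theorem mono_zero : mono I 0 = 1 := by
  show mkS I (mkR 𝕂 n 1) = 1
  rw [map_one, map_one]

theorem mono_add (s t : Fin n × ℕ →₀ ℕ) : mono I (s + t) = mono I s * mono I t := by
  rw [mono, mono, mono, ← map_mul, ← map_mul, MvPolynomial.monomial_mul, one_mul]

theorem mono_single (k : Fin n) (l : ℕ) : mono I (Finsupp.single (k, l) 1) = x I k l := rfl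

theorem mkS_surjective : Function.Surjective (mkS I) := Ideal.Quotient.mkₐ_surjective 𝕂 (J I)

variable (𝕂 n) in
theorem mkR_surjective : Function.Surjective (mkR 𝕂 n) :=
  Ideal.Quotient.mkₐ_surjective 𝕂 (Q 𝕂 n)

theorem span_mono_eq_top : Submodule.span 𝕂 (Set.range (mono I)) = ⊤ := by
  refine eq_top_iff.2 fun y _ => ?_
  obtain ⟨z, rfl⟩ := mkS_surjective I y
  obtain ⟨p, rfl⟩ := mkR_surjective 𝕂 n z
  induction p using MvPolynomial.induction_on' with
  | monomial s c =>
    rw [← mul_one c, ← smul_eq_mul, ← MvPolynomial.smul_monomial, map_smul, map_smul]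
    exact Submodule.smul_mem _ _ (Submodule.subset_span ⟨s, rfl⟩)
  | add p q hp hq => rw [map_add, map_add]; exact add_mem (hp trivial) (hq trivial)

/-- Induction for elements of `S`, starting from monomials. -/
theorem S_induction {p : S I → Prop} (y : S I) (mem : ∀ s, p (mono I s)) (zero : p 0)
    (add : ∀ y z, p y → p z → p (y + z)) (smul : ∀ (c : 𝕂) y, p y → p (c • y)) : p y := by
  have hy : y ∈ Submodule.span 𝕂 (Set.range (mono I)) := by
    rw [span_mono_eq_top]; trivial
  induction hy using Submodule.span_induction with
  | mem y hy => obtain ⟨s, rfl⟩ := hy; exact mem s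
  | zero => exact zero
  | add y z _ _ hy hz => exact add y z hy hz
  | smul c y _ hy => exact smul c y hy

theorem x_mul_x (i k : Fin n) (l : ℕ) : x I i l * x I k l = 0 := by
  rw [x, x, ← map_mul, ← map_mul]
  have : mkR 𝕂 n (MvPolynomial.X (i, l) * MvPolynomial.X (k, l)) = 0 :=
    Ideal.Quotient.eq_zero_iff_mem.2 (Ideal.subset_span ⟨i, k, l, rfl⟩)
  rw [this, map_zero]

theorem mono_eq_zero {s : Fin n × ℕ →₀ ℕ} {l : ℕ} (h : 2 ≤ place s l) : mono I s = 0 := by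
  obtain ⟨i, t, rfl⟩ := exists_eq_single_add (s := s) (l := l) (by omega)
  rw [place_add, place_single, Finsupp.add_apply, Finsupp.single_eq_same] at h
  obtain ⟨k, t, rfl⟩ := exists_eq_single_add (s := t) (l := l) (by omega)
  rw [mono_add, mono_add, mono_single, mono_single, ← mul_assoc, x_mul_x, zero_mul]

theorem iotaF_word (w : List (Fin n)) :
    iotaF 𝕂 n (word 𝕂 w) = mkR 𝕂 n (MvPolynomial.monomial (wordExp 0 w) 1) := by
  -- The starting place is generalized because the tail of a word starts one place later.
  have aux : ∀ (w : List (Fin n)) (k : ℕ),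
      ∏ l : Fin w.length, mkR 𝕂 n (MvPolynomial.X (w.get l, k + (l : ℕ))) =
        mkR 𝕂 n (MvPolynomial.monomial (wordExp k w) 1) := by
    intro w
    induction w with
    | nil => intro k; exact (map_one _).symm
    | cons a w ih =>
      intro k
      rw [wordExp_cons, ← one_mul (1 : 𝕂), ← MvPolynomial.monomial_mul, map_mul, ← ih]
      refine (Fin.prod_univ_succ (n := w.length) _).trans ?_
      refine congrArg₂ _ rfl (Finset.prod_congr rfl fun l _ => ?_)
      simp [add_assoc, add_comm 1]
  have h := (FreeAlgebra.basisFreeMonoid 𝕂 (Fin n)).constr_basis 𝕂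
    (fun w : FreeMonoid (Fin n) => ∏ l : Fin w.toList.length,
      mkR 𝕂 n (MvPolynomial.X (w.toList.get l, (l : ℕ)))) (FreeMonoid.ofList w)
  rw [basisFreeMonoid_eq_word] at h
  refine h.trans ?_
  rw [← aux]
  simp only [zero_add]
  rfl

theorem sigmaR_mkR_wordExp (k : ℕ) (w : List (Fin n)) :
    sigmaR 𝕂 n (mkR 𝕂 n (MvPolynomial.monomial (wordExp k w) 1)) =
      mkR 𝕂 n (MvPolynomial.monomial (wordExp (k + 1) w) 1) := by
  have : sigmaP 𝕂 n (MvPolynomial.monomial (wordExp k w) 1) =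
      MvPolynomial.monomial (wordExp (k + 1) w) 1 := by
    rw [sigmaP, MvPolynomial.rename_monomial]
    congr 2
    induction w generalizing k with
    | nil => simp
    | cons a w ih => simp [Finsupp.mapDomain_add, ih]
  rw [← this]
  rfl

theorem sigmaR_iterate_iotaF_word (k : ℕ) (w : List (Fin n)) :
    (sigmaR 𝕂 n)^[k] (iotaF 𝕂 n (word 𝕂 w)) =
      mkR 𝕂 n (MvPolynomial.monomial (wordExp k w) 1) := by
  induction k with
  | zero => exact iotaF_word w
  | succ k ih => rw [Function.iterate_succ_apply', ih, sigmaR_mkR_wordExp]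

end Monomials

/-! ### The shifted embeddings `σ^k ∘ ι` -/

section Up

/-- The linear map `σ^k ∘ ι : F → R`. -/
def upF (k : ℕ) : F 𝕂 n →ₗ[𝕂] R 𝕂 n := ((sigmaR 𝕂 n) ^ k).toLinearMap ∘ₗ iotaF 𝕂 n

theorem upF_apply (k : ℕ) (f : F 𝕂 n) : upF k f = (sigmaR 𝕂 n)^[k] (iotaF 𝕂 n f) := by
  rw [upF, LinearMap.comp_apply, AlgHom.toLinearMap_apply, AlgHom.coe_pow]

theorem upF_word (k : ℕ) (w : List (Fin n)) :
    upF k (word 𝕂 w) = mkR 𝕂 n (MvPolynomial.monomial (wordExp k w) 1) := by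
  rw [upF_apply, sigmaR_iterate_iotaF_word]

variable (I : Ideal (F 𝕂 n))

theorem mkS_upF_eq_zero (k : ℕ) {f : F 𝕂 n} (hf : f ∈ I) : mkS I (upF k f) = 0 :=
  Ideal.Quotient.eq_zero_iff_mem.2 (Ideal.subset_span ⟨k, f, hf, upF_apply k f⟩)

theorem mono_mem_compS (s : Fin n × ℕ →₀ ℕ) : mono I s ∈ compS I s.degree := by
  refine ⟨MvPolynomial.monomial s 1, ?_, rfl⟩
  exact MvPolynomial.isHomogeneous_monomial 1 rfl

variable [I.IsTwoSided]

/-- The linear map `σ^k ∘ ι : A → S`. -/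
def up (k : ℕ) : A I →ₗ[𝕂] S I := ((sigma I) ^ k).toLinearMap ∘ₗ iotaA I

theorem up_apply (k : ℕ) (a : A I) : up I k a = (sigma I)^[k] (iotaA I a) := by
  rw [up, LinearMap.comp_apply, AlgHom.toLinearMap_apply, AlgHom.coe_pow]

theorem up_wordA (k : ℕ) (w : List (Fin n)) : up I k (wordA I w) = mono I (wordExp k w) := by
  rw [up_apply]
  induction k with
  | zero => exact congrArg (mkS I) (iotaF_word w)
  | succ k ih =>
    rw [Function.iterate_succ_apply', ih]
    exact congrArg (mkS I) (sigmaR_mkR_wordExp k w)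

theorem iota_apply {s : ℕ} (δ : Fin s → ℕ) (f : Fin s → A I) (j : Fin s) :
    iota I δ f j = up I (δ j) (f j) := (up_apply I _ _).symm

-- A word of length `e` placed from `k` ends where the second factor starts, so the two concatenate.
-- This is why coordinate `j` of `ι` is shifted by `Δ_j`.
variable {I} in
theorem up_mul_up {e : ℕ} {a : A I} (ha : a ∈ compA I e) (k : ℕ) (b : A I) :
    up I k a * up I (k + e) b = up I k (a * b) := by
  rw [compA_eq_span] at ha
  have hb : b ∈ Submodule.span 𝕂 (Set.range (wordA I)) := by rw [span_wordA_eq_top]; trivial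
  induction ha using Submodule.span_induction with
  | mem a ha =>
    obtain ⟨u, rfl, rfl⟩ := ha
    induction hb using Submodule.span_induction with
    | mem b hb =>
      obtain ⟨w, rfl⟩ := hb
      rw [← wordA_append, up_wordA, up_wordA, up_wordA, wordExp_append, mono_add]
    | zero => simp
    | add x y _ _ hx hy => rw [mul_add, map_add, map_add, mul_add, hx, hy]
    | smul c x _ hx => rw [mul_smul_comm, map_smul, map_smul, mul_smul_comm, hx]
  | zero => simp
  | add x y _ _ hx hy => rw [add_mul, map_add, map_add, add_mul, hx, hy]
  | smul c x _ hx => rw [smul_mul_assoc, map_smul, map_smul, smul_mul_assoc, hx]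

theorem wordExp_degree (k : ℕ) (w : List (Fin n)) : (wordExp k w).degree = w.length := by
  induction w generalizing k with
  | nil => simp
  | cons a w ih => simp [ih, add_comm 1]

theorem up_mem_compS {e : ℕ} {a : A I} (ha : a ∈ compA I e) (k : ℕ) : up I k a ∈ compS I e := by
  rw [compA_eq_span] at ha
  induction ha using Submodule.span_induction with
  | mem a ha =>
    obtain ⟨w, rfl, rfl⟩ := ha
    rw [up_wordA, ← wordExp_degree k w]
    exact mono_mem_compS I _
  | zero => rw [map_zero]; exact zero_mem _
  | add x y _ _ hx hy => rw [map_add]; exact add_mem hx hy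
  | smul c x _ hx => rw [map_smul]; exact Submodule.smul_mem _ _ hx

end Up

/-! ### Linear maps on `P` that descend to `S` -/

section Lift

/-- The linear map `F → P` which puts the letters of a word in consecutive places, starting from
the place `k`. -/
def upP (k : ℕ) : F 𝕂 n →ₗ[𝕂] P 𝕂 n :=
  (FreeAlgebra.basisFreeMonoid 𝕂 (Fin n)).constr 𝕂 fun w =>
    MvPolynomial.monomial (wordExp k w.toList) 1

theorem upP_word (k : ℕ) (w : List (Fin n)) :
    upP k (word 𝕂 w) = MvPolynomial.monomial (wordExp k w) 1 := by
  rw [← FreeMonoid.toList_ofList w, ← basisFreeMonoid_eq_word, upP, Module.Basis.constr_basis]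

theorem mkR_upP (k : ℕ) (f : F 𝕂 n) : mkR 𝕂 n (upP k f) = upF k f := by
  have h : (mkR 𝕂 n).toLinearMap ∘ₗ upP k = upF k := by
    refine LinearMap.ext_on_range span_word_eq_top fun w => ?_
    rw [upF_word, LinearMap.comp_apply, upP_word]
    rfl
  exact congrArg (fun ℓ => ℓ f) h

theorem linearMap_mul_eq_zero {E : Type*} [AddCommGroup E] [Module 𝕂 E] {ℓ : P 𝕂 n →ₗ[𝕂] E}
    {p : P 𝕂 n} (h : ∀ t, ℓ (MvPolynomial.monomial t 1 * p) = 0) (q : P 𝕂 n) : ℓ (q * p) = 0 := by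
  induction q using MvPolynomial.induction_on' with
  | monomial t c =>
    have : MvPolynomial.monomial t c = c • MvPolynomial.monomial t (1 : 𝕂) := by
      rw [MvPolynomial.smul_monomial, smul_eq_mul, mul_one]
    rw [this, smul_mul_assoc, map_smul, h, smul_zero]
  | add q q' hq hq' => rw [add_mul, map_add, hq, hq', add_zero]

theorem IsGradedIdeal.eq_zero_of_homogeneous {I : Ideal (F 𝕂 n)} (hI : IsGradedIdeal I)
    {E : Type*} [AddCommGroup E] [Module 𝕂 E] {ℓ : F 𝕂 n →ₗ[𝕂] E}
    (h : ∀ e, ∀ f ∈ I, f ∈ compF 𝕂 n e → ℓ f = 0) {f : F 𝕂 n} (hf : f ∈ I) : ℓ f = 0 := by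
  have hf' : f ∈ I.restrictScalars 𝕂 := hf
  rw [hI] at hf'
  refine (iSup_le fun e => ?_ : _ ≤ LinearMap.ker ℓ) hf'
  exact fun f hf => h e f hf.1 hf.2

/-- A linear map on `P` which vanishes on the multiples of the generators of `Q` and of the
homogeneous generators of `J` induces a map on `S`. -/
theorem eq_zero_of_mkS_eq_zero {I : Ideal (F 𝕂 n)} (hI : IsGradedIdeal I)
    {E : Type*} [AddCommGroup E] [Module 𝕂 E] {ℓ : P 𝕂 n →ₗ[𝕂] E}
    (hQ : ∀ t i k l, ℓ (MvPolynomial.monomial t 1 *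
      (MvPolynomial.X (i, l) * MvPolynomial.X (k, l))) = 0)
    (hJ : ∀ t k e, ∀ f ∈ I, f ∈ compF 𝕂 n e → ℓ (MvPolynomial.monomial t 1 * upP k f) = 0)
    {p : P 𝕂 n} (hp : mkS I (mkR 𝕂 n p) = 0) : ℓ p = 0 := by
  have kerR : ∀ p ∈ Q 𝕂 n, ∀ q, ℓ (q * p) = 0 := by
    intro p hp
    induction hp using Submodule.span_induction with
    | mem p hp =>
      obtain ⟨i, k, l, rfl⟩ := hp
      exact linearMap_mul_eq_zero fun t => hQ t i k l
    | zero => intro q; rw [mul_zero, map_zero]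
    | add p p' _ _ hp hp' => intro q; rw [mul_add, map_add, hp, hp', add_zero]
    | smul a p _ hp => intro q; rw [smul_eq_mul, ← mul_assoc, hp]
  -- An element of `J` lives in `R`, so only some lift of it is controlled; two lifts differ by an
  -- element of `Q`, which `kerR` handles.
  have key : ∀ z ∈ J I, ∃ p, mkR 𝕂 n p = z ∧ ∀ q, ℓ (q * p) = 0 := by
    intro z hz
    induction hz using Submodule.span_induction with
    | mem z hz =>
      obtain ⟨k, f, hf, rfl⟩ := hz
      rw [← upF_apply]
      refine ⟨upP k f, mkR_upP k f, linearMap_mul_eq_zero fun t => ?_⟩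
      exact hI.eq_zero_of_homogeneous
        (ℓ := ℓ ∘ₗ LinearMap.mulLeft 𝕂 (MvPolynomial.monomial t 1) ∘ₗ upP k)
        (fun e f hf hf' => hJ t k e f hf hf') hf
    | zero => exact ⟨0, map_zero _, fun q => by rw [mul_zero, map_zero]⟩
    | add y z _ _ hy hz =>
      obtain ⟨p, rfl, hp⟩ := hy
      obtain ⟨p', rfl, hp'⟩ := hz
      exact ⟨p + p', map_add _ _ _, fun q => by rw [mul_add, map_add, hp, hp', add_zero]⟩
    | smul a z _ hz =>
      obtain ⟨p, rfl, hp⟩ := hz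
      obtain ⟨a, rfl⟩ := mkR_surjective 𝕂 n a
      exact ⟨a * p, map_mul _ _ _, fun q => by rw [← mul_assoc, hp]⟩
  obtain ⟨p', hp', h⟩ := key _ (Ideal.Quotient.eq_zero_iff_mem.1 hp)
  have hmem : mkR 𝕂 n (p - p') = 0 := by rw [map_sub, hp', sub_self]
  have h' := kerR (p - p') (Ideal.Quotient.eq_zero_iff_mem.1 hmem) 1
  rw [one_mul, map_sub, sub_eq_zero] at h'
  rw [h', ← one_mul p', h]

theorem mkS_comp_mkR_surjective (I : Ideal (F 𝕂 n)) :
    Function.Surjective ((mkS I).comp (mkR 𝕂 n)) :=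
  (mkS_surjective I).comp (mkR_surjective 𝕂 n)

end Lift

/-! ### Algebra maps out of `S` prescribed place by place -/

section Twist

variable {I : Ideal (F 𝕂 n)} {C : Type*} [CommRing C] [Algebra 𝕂 C]

/-- The algebra homomorphism `P → C` which maps the variable `(k, l)` to `t l * α l (x k l)`. -/
def twistP (t : ℕ → C) (α : ℕ → S I →ₐ[𝕂] C) : P 𝕂 n →ₐ[𝕂] C :=
  MvPolynomial.aeval fun p => t p.2 * α p.2 (x I p.1 p.2)

/-- The compatibility of `α` with intervals of places on which `t` does not vanish. -/
def TwistCompat (t : ℕ → C) (α : ℕ → S I →ₐ[𝕂] C) : Prop :=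
  ∀ l, t l = 0 ∨ t (l + 1) = 0 ∨ α l = α (l + 1)

/-- Wherever `α` changes between two adjacent places of the word, one of the two factors `t`
vanishes; so the first `α` may be used throughout. -/
theorem twistP_wordExp {t : ℕ → C} {α : ℕ → S I →ₐ[𝕂] C} (h : TwistCompat t α) (k : ℕ)
    (w : List (Fin n)) :
    twistP t α (MvPolynomial.monomial (wordExp k w) 1) =
      (∏ i ∈ Finset.range w.length, t (k + i)) * α k (mono I (wordExp k w)) := by
  induction w generalizing k with
  | nil =>
    rw [wordExp_nil, mono_zero, map_one (α k)]
    simp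
  | cons a w ih =>
    have h1 : (MvPolynomial.monomial (wordExp k (a :: w)) (1 : 𝕂)) =
        MvPolynomial.X (a, k) * MvPolynomial.monomial (wordExp (k + 1) w) 1 := by
      rw [MvPolynomial.X, MvPolynomial.monomial_mul, one_mul, wordExp_cons]
    rw [h1, map_mul, ih, wordExp_cons, mono_add, mono_single, map_mul, List.length_cons,
      Finset.prod_range_succ']
    have h2 : twistP t α (MvPolynomial.X (a, k)) = t k * α k (x I a k) := by simp [twistP]
    rw [h2]
    simp only [add_assoc, add_comm 1, add_zero]
    rcases h k with h | h | h
    · simp [h]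
    -- A remaining letter supplies the zero factor `t (k + 1)`; with no letter left, both `α` are
    -- applied to `1`.
    · cases w with
      | nil => simp
      | cons b w => simp [Finset.prod_range_succ', h]
    · rw [h]; ring

/-- On words of a fixed length and starting place the product of the `t` is constant. It factors out
of a homogeneous relation, leaving an algebra map applied to zero. -/
theorem twistP_eq_zero (hI : IsGradedIdeal I) {t : ℕ → C} {α : ℕ → S I →ₐ[𝕂] C}
    (h : TwistCompat t α) {p : P 𝕂 n} (hp : mkS I (mkR 𝕂 n p) = 0) : twistP t α p = 0 := by
  refine eq_zero_of_mkS_eq_zero hI (ℓ := (twistP t α).toLinearMap) ?_ ?_ hp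
  · intro s i k l
    have : twistP t α (MvPolynomial.X (i, l)) * twistP t α (MvPolynomial.X (k, l)) = 0 := by
      simp only [twistP, MvPolynomial.aeval_X]
      rw [mul_mul_mul_comm, ← map_mul, x_mul_x, map_zero, mul_zero]
    rw [AlgHom.toLinearMap_apply, map_mul, map_mul, this, mul_zero]
  · intro s k e f hf hf'
    rw [AlgHom.toLinearMap_apply, map_mul]
    have : ∀ f ∈ compF 𝕂 n e, twistP t α (upP k f) =
        (∏ i ∈ Finset.range e, t (k + i)) * α k (mkS I (upF k f)) := by
      intro f hf
      rw [compF_eq_span] at hf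
      induction hf using Submodule.span_induction with
      | mem f hf =>
        obtain ⟨w, rfl, rfl⟩ := hf
        rw [upP_word, twistP_wordExp h, upF_word, mono]
      | zero => simp
      | add f f' _ _ hf hf' => simp only [map_add, hf, hf', mul_add]
      | smul c f _ hf => simp only [map_smul, hf, mul_smul_comm]
    rw [this f hf', mkS_upF_eq_zero I k hf, map_zero, mul_zero, mul_zero]

theorem twistCompat_const (t : ℕ → C) (α : S I →ₐ[𝕂] C) : TwistCompat t fun _ => α :=
  fun _ => Or.inr (Or.inr rfl)

/-- The algebra homomorphism `S → C` which maps `x k l` to `t l * α l (x k l)`. -/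
def twist (hI : IsGradedIdeal I) (t : ℕ → C) (α : ℕ → S I →ₐ[𝕂] C) (h : TwistCompat t α) :
    S I →ₐ[𝕂] C :=
  (Ideal.Quotient.liftₐ (RingHom.ker ((mkS I).comp (mkR 𝕂 n))) (twistP t α)
    fun _ hp => twistP_eq_zero hI h hp).comp
    (Ideal.quotientKerAlgEquivOfSurjective (mkS_comp_mkR_surjective I)).symm.toAlgHom

theorem twist_x (hI : IsGradedIdeal I) {t : ℕ → C} {α : ℕ → S I →ₐ[𝕂] C} (h : TwistCompat t α)
    (k : Fin n) (l : ℕ) : twist hI t α h (x I k l) = t l * α l (x I k l) := by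
  have h1 : (Ideal.quotientKerAlgEquivOfSurjective (mkS_comp_mkR_surjective I)).symm (x I k l) =
      Ideal.Quotient.mk _ (MvPolynomial.X (k, l)) := by
    rw [AlgEquiv.symm_apply_eq]; rfl
  have h2 : twist hI t α h (x I k l) = twistP t α (MvPolynomial.X (k, l)) := by
    rw [twist, AlgHom.comp_apply]
    refine (congrArg (Ideal.Quotient.liftₐ _ (twistP t α) _) h1).trans ?_
    rfl
  rw [h2]
  simp [twistP]

theorem algHom_mono_eq {f g : S I →ₐ[𝕂] C} {s : Fin n × ℕ →₀ ℕ}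
    (h : ∀ l, place s l ≠ 0 → ∀ k, f (x I k l) = g (x I k l)) : f (mono I s) = g (mono I s) := by
  induction hd : s.degree generalizing s with
  | zero =>
    rw [(Finsupp.degree_eq_zero_iff s).1 hd, mono_zero, map_one, map_one]
  | succ d ih =>
    have hs : s ≠ 0 := by rintro rfl; simp at hd
    obtain ⟨p, hp⟩ := Finsupp.ne_iff.1 hs
    have hpl : place s p.2 ≠ 0 := by
      have := le_place s p
      rw [Finsupp.zero_apply] at hp
      omega
    obtain ⟨k, s, rfl⟩ := exists_eq_single_add hpl
    rw [mono_add, map_mul, map_mul, mono_single, h _ hpl, ih]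
    · intro l hl
      refine h l ?_
      rw [place_add, Finsupp.add_apply]
      omega
    · simp at hd
      omega

end Twist

/-! ### Killing the variables outside a set of places -/

section Restrict

variable {I : Ideal (F 𝕂 n)} (hI : IsGradedIdeal I)

open Classical in
/-- The endomorphism of `S` which kills the variables whose place is not in `T`. -/
def restrict (T : Set ℕ) : S I →ₐ[𝕂] S I :=
  twist hI (fun l => if l ∈ T then 1 else 0) (fun _ => AlgHom.id 𝕂 _)
    (twistCompat_const _ _)

theorem restrict_x_of_mem {T : Set ℕ} {l : ℕ} (h : l ∈ T) (k : Fin n) :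
    restrict hI T (x I k l) = x I k l := by
  simp [restrict, twist_x, h]

theorem restrict_x_of_notMem {T : Set ℕ} {l : ℕ} (h : l ∉ T) (k : Fin n) :
    restrict hI T (x I k l) = 0 := by
  simp [restrict, twist_x, h]

theorem restrict_mono_of_forall {T : Set ℕ} {s : Fin n × ℕ →₀ ℕ}
    (h : ∀ l, place s l ≠ 0 → l ∈ T) : restrict hI T (mono I s) = mono I s :=
  algHom_mono_eq (g := AlgHom.id 𝕂 _) fun l hl k => restrict_x_of_mem hI (h l hl) k

theorem restrict_mono_of_notMem {T : Set ℕ} {s : Fin n × ℕ →₀ ℕ} {l : ℕ}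
    (hl : place s l ≠ 0) (h : l ∉ T) : restrict hI T (mono I s) = 0 := by
  obtain ⟨k, s, rfl⟩ := exists_eq_single_add hl
  rw [mono_add, map_mul, mono_single, restrict_x_of_notMem hI h, zero_mul]

/-- With `restrict_mem_Strunc`, this makes restriction to the places below `d` a retraction of `S`
onto `S(d)`, which carries relations over `S` to relations over `S(d)`. -/
theorem restrict_of_mem_Strunc {d : ℕ} {y : S I} (hy : y ∈ Strunc I d) :
    restrict hI (Set.Iio d) y = y := by
  have : Strunc I d ≤ AlgHom.equalizer (restrict hI (Set.Iio d)) (AlgHom.id 𝕂 _) := by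
    refine Algebra.adjoin_le ?_
    rintro _ ⟨k, l, hl, rfl⟩
    exact restrict_x_of_mem hI (T := Set.Iio d) hl k
  exact this hy

theorem mono_mem_Strunc {d : ℕ} {s : Fin n × ℕ →₀ ℕ} (h : ∀ l, place s l ≠ 0 → l < d) :
    mono I s ∈ Strunc I d := by
  induction hd : s.degree generalizing s with
  | zero => rw [(Finsupp.degree_eq_zero_iff s).1 hd, mono_zero]; exact one_mem _
  | succ e ih =>
    have hs : s ≠ 0 := by rintro rfl; simp at hd
    obtain ⟨p, hp⟩ := Finsupp.ne_iff.1 hs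
    have hpl : place s p.2 ≠ 0 := by
      have := le_place s p
      rw [Finsupp.zero_apply] at hp
      omega
    obtain ⟨k, s, rfl⟩ := exists_eq_single_add hpl
    rw [mono_add, mono_single]
    refine mul_mem (Algebra.subset_adjoin ⟨k, _, h _ hpl, rfl⟩) (ih ?_ ?_)
    · intro l hl
      refine h l ?_
      rw [place_add, Finsupp.add_apply]
      omega
    · simp at hd
      omega

theorem restrict_mem_Strunc (d : ℕ) (y : S I) : restrict hI (Set.Iio d) y ∈ Strunc I d := by
  induction y using S_induction with
  | mem s =>
    by_cases h : ∀ l, place s l ≠ 0 → l ∈ Set.Iio d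
    · rw [restrict_mono_of_forall hI h]
      exact mono_mem_Strunc h
    · push Not at h
      obtain ⟨l, hl, hl'⟩ := h
      rw [restrict_mono_of_notMem hI hl hl']
      exact zero_mem _
  | zero => rw [map_zero]; exact zero_mem _
  | add y z hy hz => rw [map_add]; exact add_mem hy hz
  | smul c y hy => rw [map_smul]; exact Subalgebra.smul_mem _ hy c

theorem restrict_mem_Strunc_of_mem {d : ℕ} (T : Set ℕ) {y : S I} (hy : y ∈ Strunc I d) :
    restrict hI T y ∈ Strunc I d := by
  have : Strunc I d ≤ (Strunc I d).comap (restrict hI T) := by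
    refine Algebra.adjoin_le ?_
    rintro _ ⟨k, l, hl, rfl⟩
    by_cases h : l ∈ T
    · rw [SetLike.mem_coe, Subalgebra.mem_comap, restrict_x_of_mem hI h]
      exact Algebra.subset_adjoin ⟨k, l, hl, rfl⟩
    · rw [SetLike.mem_coe, Subalgebra.mem_comap, restrict_x_of_notMem hI h]
      exact zero_mem _
  exact this hy

variable [I.IsTwoSided]

theorem restrict_up_of_subset {T : Set ℕ} {k e : ℕ} (h : ∀ l, k ≤ l → l < k + e → l ∈ T) {a : A I}
    (ha : a ∈ compA I e) : restrict hI T (up I k a) = up I k a := by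
  rw [compA_eq_span] at ha
  induction ha using Submodule.span_induction with
  | mem a ha =>
    obtain ⟨w, rfl, rfl⟩ := ha
    rw [up_wordA]
    refine restrict_mono_of_forall hI fun l hl => ?_
    rw [place_wordExp, interval_apply] at hl
    split_ifs at hl with hl'
    · exact h l hl'.1 hl'.2
    · exact absurd rfl hl
  | zero => simp
  | add a b _ _ ha hb => simp only [map_add, ha, hb]
  | smul c a _ ha => simp only [map_smul, ha]

/-- Every word of length `e` placed from `k` occupies all of `[k, k + e)`, so one missing place is
enough. -/
theorem restrict_up_eq_zero {T : Set ℕ} {k e l : ℕ} (hk : k ≤ l) (hl : l < k + e) (h : l ∉ T)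
    {a : A I} (ha : a ∈ compA I e) : restrict hI T (up I k a) = 0 := by
  rw [compA_eq_span] at ha
  induction ha using Submodule.span_induction with
  | mem a ha =>
    obtain ⟨w, rfl, rfl⟩ := ha
    rw [up_wordA]
    refine restrict_mono_of_notMem hI (l := l) ?_ h
    rw [place_wordExp, interval_apply, if_pos ⟨hk, hl⟩]
    exact one_ne_zero
  | zero => simp
  | add a b _ _ ha hb => simp only [map_add, ha, hb, add_zero]
  | smul c a _ ha => simp only [map_smul, ha, smul_zero]

theorem up_mem_Strunc {k e d : ℕ} (h : k + e ≤ d) {a : A I} (ha : a ∈ compA I e) :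
    up I k a ∈ Strunc I d := by
  rw [compA_eq_span] at ha
  induction ha using Submodule.span_induction with
  | mem a ha =>
    obtain ⟨w, rfl, rfl⟩ := ha
    rw [up_wordA]
    refine mono_mem_Strunc fun l hl => ?_
    rw [place_wordExp, interval_apply] at hl
    split_ifs at hl with hl'
    · omega
    · exact absurd rfl hl
  | zero => rw [map_zero]; exact zero_mem _
  | add a b _ _ ha hb => rw [map_add]; exact add_mem ha hb
  | smul c a _ ha => rw [map_smul]; exact Subalgebra.smul_mem _ ha c

end Restrict

/-! ### Multihomogeneous components by way of a coaction -/

section Multidegree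

variable {I : Ideal (F 𝕂 n)} (hI : IsGradedIdeal I)

/-- The coaction of the torus of places: `x k l ↦ t_l x k l`. -/
def coaction : S I →ₐ[𝕂] MvPolynomial ℕ (S I) :=
  twist hI MvPolynomial.X (fun _ => IsScalarTower.toAlgHom 𝕂 (S I) _)
    (twistCompat_const _ _)

theorem coaction_x (k : Fin n) (l : ℕ) :
    coaction hI (x I k l) = MvPolynomial.monomial (Finsupp.single l 1) (x I k l) := by
  rw [coaction, twist_x, mul_comm]
  exact MvPolynomial.C_mul_X_eq_monomial

theorem coaction_mono (s : Fin n × ℕ →₀ ℕ) :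
    coaction hI (mono I s) = MvPolynomial.monomial (place s) (mono I s) := by
  induction hd : s.degree generalizing s with
  | zero =>
    rw [(Finsupp.degree_eq_zero_iff s).1 hd, mono_zero, map_one, place_zero]; rfl
  | succ d ih =>
    have hs : s ≠ 0 := by rintro rfl; simp at hd
    obtain ⟨p, hp⟩ := Finsupp.ne_iff.1 hs
    have hpl : place s p.2 ≠ 0 := by
      have := le_place s p
      rw [Finsupp.zero_apply] at hp
      omega
    obtain ⟨k, s, rfl⟩ := exists_eq_single_add hpl
    rw [mono_add, map_mul, mono_single, coaction_x, ih, MvPolynomial.monomial_mul, place_add,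
      place_single]
    simp at hd
    omega

/-- Setting all torus parameters to `1` adds the multihomogeneous components up again. -/
theorem eval_one_coaction (y : S I) : MvPolynomial.eval (fun _ => 1) (coaction hI y) = y := by
  induction y using S_induction with
  | mem s => rw [coaction_mono, MvPolynomial.eval_monomial]; simp
  | zero => rw [map_zero, map_zero]
  | add y z hy hz => rw [map_add, map_add, hy, hz]
  | smul c y hy => 
    rw [map_smul, algebra_compatible_smul (S I) c (coaction hI y), MvPolynomial.smul_eval, hy,
      Algebra.smul_def]

/-- The shift `W` will be the multidegree of `ε'_j`, so that `U` is the multidegree in the free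
module. -/
theorem coeff_coaction_mem (W U : ℕ →₀ ℕ) (y : S I) :
    MvPolynomial.coeff U (MvPolynomial.monomial W 1 * coaction hI y) ∈
      Submodule.span 𝕂 (mono I '' {s | W + place s = U}) := by
  induction y using S_induction with
  | mem s =>
    rw [coaction_mono, MvPolynomial.monomial_mul, MvPolynomial.coeff_monomial, one_mul]
    split_ifs with h
    · exact Submodule.subset_span ⟨s, h, rfl⟩
    · exact zero_mem _
  | zero => rw [map_zero, mul_zero, MvPolynomial.coeff_zero]; exact zero_mem _
  | add y z hy hz => rw [map_add, mul_add, MvPolynomial.coeff_add]; exact add_mem hy hz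
  | smul c y hy =>
    rw [map_smul, mul_smul_comm, MvPolynomial.coeff_smul]
    exact Submodule.smul_mem _ c hy

variable [I.IsTwoSided]

theorem coaction_up {e : ℕ} {a : A I} (ha : a ∈ compA I e) (k : ℕ) :
    coaction hI (up I k a) = MvPolynomial.monomial (interval k e) (up I k a) := by
  rw [compA_eq_span] at ha
  induction ha using Submodule.span_induction with
  | mem a ha =>
    obtain ⟨w, rfl, rfl⟩ := ha
    rw [up_wordA, coaction_mono, place_wordExp]
  | zero => simp
  | add a b _ _ ha hb => simp only [map_add, ha, hb]
  | smul c a _ ha => simp only [map_smul, ha, MvPolynomial.smul_monomial]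

end Multidegree

/-! ### Reading a monomial as a word in `A` -/

section Collapse

variable (I : Ideal (F 𝕂 n)) [I.IsTwoSided]

/-- The factor at the place `l` of the monomial with exponent `s`: it is `1` if there is no letter
at this place, the letter if there is exactly one, and `0` otherwise. -/
def letter (s : Fin n × ℕ →₀ ℕ) (l : ℕ) : A I :=
  if place s l = 0 then 1 else if place s l = 1 then ∑ k, s (k, l) • wordA I [k] else 0

theorem letter_of_eq_zero {s : Fin n × ℕ →₀ ℕ} {l : ℕ} (h : place s l = 0) :
    letter I s l = 1 := if_pos h

theorem letter_of_two_le {s : Fin n × ℕ →₀ ℕ} {l : ℕ} (h : 2 ≤ place s l) :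
    letter I s l = 0 := by
  rw [letter, if_neg (by omega), if_neg (by omega)]

theorem letter_add_of_eq_zero {s t : Fin n × ℕ →₀ ℕ} {l : ℕ} (h : place t l = 0) :
    letter I (s + t) l = letter I s l := by
  have h' : ∀ k, t (k, l) = 0 := fun k => by
    have := le_place t (k, l)
    simp only at this
    omega
  simp [letter, place_add, h, h']

theorem letter_single_add {s : Fin n × ℕ →₀ ℕ} {l : ℕ} (h : place s l = 0) (k : Fin n) :
    letter I (Finsupp.single (k, l) 1 + s) l = wordA I [k] := by
  classical
  rw [letter_add_of_eq_zero I h, letter]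
  simp [Finsupp.single_apply, Finset.sum_ite_eq]

theorem letter_mem_compA (s : Fin n × ℕ →₀ ℕ) (l : ℕ) : letter I s l ∈ compA I (place s l) := by
  rw [letter]
  split_ifs with h h'
  · rw [h]; exact one_mem_compA I
  · rw [h']; exact sum_mem fun k _ => nsmul_mem (wordA_mem_compA I [k]) _
  · exact zero_mem _

/-- The ordered product of the factors at the places in `[k, k + e)`. -/
def readWord (s : Fin n × ℕ →₀ ℕ) (k e : ℕ) : A I := ((List.range' k e).map (letter I s)).prod

theorem readWord_zero (s : Fin n × ℕ →₀ ℕ) (k : ℕ) : readWord I s k 0 = 1 := by simp [readWord]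

theorem readWord_succ (s : Fin n × ℕ →₀ ℕ) (k e : ℕ) :
    readWord I s k (e + 1) = letter I s k * readWord I s (k + 1) e := by
  simp [readWord, List.range'_succ]

theorem readWord_add (s : Fin n × ℕ →₀ ℕ) (k e e' : ℕ) :
    readWord I s k (e + e') = readWord I s k e * readWord I s (k + e) e' := by
  rw [readWord, readWord, readWord, ← List.prod_append, ← List.map_append, List.range'_append_1]

theorem readWord_congr {s t : Fin n × ℕ →₀ ℕ} {k e : ℕ}
    (h : ∀ l, k ≤ l → l < k + e → letter I s l = letter I t l) :
    readWord I s k e = readWord I t k e := by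
  rw [readWord, readWord]
  congr 1
  refine List.map_congr_left fun l hl => ?_
  rw [List.mem_range'_1] at hl
  exact h l hl.1 hl.2

theorem readWord_eq_one {s : Fin n × ℕ →₀ ℕ} {k e : ℕ}
    (h : ∀ l, k ≤ l → l < k + e → place s l = 0) : readWord I s k e = 1 := by
  induction e generalizing k with
  | zero => exact readWord_zero I s k
  | succ e ih =>
    rw [readWord_succ, letter_of_eq_zero I (h k le_rfl (by omega)), one_mul, ih]
    exact fun l hl hl' => h l (by omega) (by omega)

theorem readWord_eq_zero {s : Fin n × ℕ →₀ ℕ} {k e l : ℕ} (hk : k ≤ l) (hl : l < k + e)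
    (h : 2 ≤ place s l) : readWord I s k e = 0 := by
  obtain ⟨i, rfl⟩ := Nat.exists_eq_add_of_le hk
  obtain ⟨e, rfl⟩ : ∃ e', e = i + (e' + 1) := ⟨e - i - 1, by omega⟩
  rw [readWord_add, readWord_succ, letter_of_two_le I h, zero_mul, mul_zero]

theorem readWord_wordExp {s : Fin n × ℕ →₀ ℕ} {k : ℕ} {w : List (Fin n)}
    (h : ∀ l, k ≤ l → l < k + w.length → place s l = 0) :
    readWord I (s + wordExp k w) k w.length = wordA I w := by
  induction w generalizing k with
  | nil => simp [readWord_zero]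
  | cons a w ih =>
    rw [List.length_cons] at h ⊢
    rw [readWord_succ, wordA_cons, ← ih (k := k + 1) fun l hl hl' => h l (by omega) (by omega)]
    congr 1
    · rw [wordExp_cons, add_left_comm, letter_single_add]
      rw [place_add, Finsupp.add_apply, h k le_rfl (by omega), place_wordExp, interval_apply,
        if_neg (by omega)]
    · refine readWord_congr I fun l hl hl' => ?_
      rw [wordExp_cons, ← add_assoc, add_right_comm, letter_add_of_eq_zero]
      rw [place_single, Finsupp.single_apply, if_neg (by simp only; omega)]

theorem readWord_mem_compA (s : Fin n × ℕ →₀ ℕ) (k e : ℕ) :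
    readWord I s k e ∈ compA I (∑ l ∈ Finset.range e, place s (k + l)) := by
  induction e generalizing k with
  | zero => rw [readWord_zero, Finset.range_zero, Finset.sum_empty]; exact one_mem_compA I
  | succ e ih =>
    rw [readWord_succ, Finset.sum_range_succ', add_comm]
    refine mul_mem_compA (letter_mem_compA I s k) ?_
    simpa only [add_assoc, add_comm 1] using ih (k + 1)

theorem exists_place_bound (s : Fin n × ℕ →₀ ℕ) : ∃ N, ∀ l, N ≤ l → place s l = 0 := by
  refine ⟨(place s).support.sup id + 1, fun l hl => ?_⟩
  by_contra h
  have := Finset.le_sup (f := id) (Finsupp.mem_support_iff.2 h)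
  simp only [id] at this
  omega

/-- The linear map `P → A` which reads the letters of a monomial in the order of their places. -/
def collapseP : P 𝕂 n →ₗ[𝕂] A I :=
  (MvPolynomial.basisMonomials (Fin n × ℕ) 𝕂).constr 𝕂 fun s =>
    readWord I s 0 (exists_place_bound s).choose

variable {I}

theorem collapseP_monomial {s : Fin n × ℕ →₀ ℕ} {N : ℕ} (h : ∀ l, N ≤ l → place s l = 0) :
    collapseP I (MvPolynomial.monomial s 1) = readWord I s 0 N := by
  have h0 := (MvPolynomial.basisMonomials (Fin n × ℕ) 𝕂).constr_basis 𝕂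
    (fun s => readWord I s 0 (exists_place_bound s).choose) s
  rw [MvPolynomial.coe_basisMonomials] at h0
  refine h0.trans ?_
  have hN := (exists_place_bound s).choose_spec
  set N' := (exists_place_bound s).choose
  have aux : ∀ a b, (∀ l, a ≤ l → place s l = 0) → a ≤ b →
      readWord I s 0 b = readWord I s 0 a := by
    intro a b ha hab
    obtain ⟨c, rfl⟩ := Nat.exists_eq_add_of_le hab
    rw [readWord_add, readWord_eq_one I (k := 0 + a) fun l hl _ => ha l (by omega), mul_one]
  rcases le_total N N' with h' | h'
  · exact aux _ _ h h'
  · exact (aux _ _ hN h').symm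

theorem collapseP_add_wordExp {s : Fin n × ℕ →₀ ℕ} {k N : ℕ} {w : List (Fin n)}
    (h : ∀ l, k ≤ l → l < k + w.length → place s l = 0)
    (hN : ∀ l, k + w.length + N ≤ l → place s l = 0) :
    collapseP I (MvPolynomial.monomial (s + wordExp k w) 1) =
      readWord I s 0 k * wordA I w * readWord I s (k + w.length) N := by
  have hw : ∀ l, l < k ∨ k + w.length ≤ l → place (wordExp k w) l = 0 := by
    intro l hl
    rw [place_wordExp, interval_apply, if_neg (by omega)]
  rw [collapseP_monomial (N := k + w.length + N), readWord_add, readWord_add, zero_add, zero_add,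
    readWord_wordExp I h]
  · congr 1
    · congr 1
      exact readWord_congr I fun l _ hl => letter_add_of_eq_zero I (hw l (by omega))
    · exact readWord_congr I fun l hl _ => letter_add_of_eq_zero I (hw l (by omega))
  · intro l hl
    rw [place_add, Finsupp.add_apply, hN l hl, hw l (by omega)]

theorem collapseP_eq_zero {s : Fin n × ℕ →₀ ℕ} {l : ℕ} (h : 2 ≤ place s l) :
    collapseP I (MvPolynomial.monomial s 1) = 0 := by
  obtain ⟨N, hN⟩ := exists_place_bound s
  rw [collapseP_monomial hN, readWord_eq_zero I (Nat.zero_le l) ?_ h]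
  by_contra h'
  have := hN l (by omega)
  omega

/-- If `s` is empty on `[k, k + e)`, the reading is `u f v`, which is zero in `A` because `I` is
two-sided. Otherwise every monomial has two letters at one place. -/
theorem collapseP_mul_upP {s : Fin n × ℕ →₀ ℕ} {k e : ℕ} {f : F 𝕂 n} (hfI : f ∈ I)
    (hf : f ∈ compF 𝕂 n e) : collapseP I (MvPolynomial.monomial s 1 * upP k f) = 0 := by
  rw [compF_eq_span] at hf
  by_cases h : ∀ l, k ≤ l → l < k + e → place s l = 0
  · obtain ⟨N, hN⟩ := exists_place_bound s
    have key : collapseP I (MvPolynomial.monomial s 1 * upP k f) =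
        readWord I s 0 k * Ideal.Quotient.mkₐ 𝕂 I f * readWord I s (k + e) N := by
      -- The formula is linear in `f` and is checked on words, which need not lie in `I`.
      clear hfI
      induction hf using Submodule.span_induction with
      | mem f hf =>
        obtain ⟨w, rfl, rfl⟩ := hf
        rw [upP_word, MvPolynomial.monomial_mul, one_mul, collapseP_add_wordExp h]
        · rfl
        · exact fun l hl => hN l (by omega)
      | zero => simp
      | add f f' _ _ hf hf' => simp only [map_add, mul_add, add_mul, hf, hf']
      | smul c f _ hf => simp only [map_smul, mul_smul_comm, smul_mul_assoc, hf]
    have h0 : Ideal.Quotient.mkₐ 𝕂 I f = 0 := Ideal.Quotient.eq_zero_iff_mem.2 hfI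
    rw [key, h0, mul_zero, zero_mul]
  · push Not at h
    obtain ⟨l, hk, hl, h⟩ := h
    clear hfI
    induction hf using Submodule.span_induction with
    | mem f hf =>
      obtain ⟨w, rfl, rfl⟩ := hf
      rw [upP_word, MvPolynomial.monomial_mul, one_mul]
      refine collapseP_eq_zero (l := l) ?_
      rw [place_add, Finsupp.add_apply, place_wordExp, interval_apply, if_pos ⟨hk, hl⟩]
      omega
    | zero => simp
    | add f f' _ _ hf hf' => simp only [map_add, mul_add, hf, hf', add_zero]
    | smul c f _ hf => simp only [map_smul, mul_smul_comm, hf, smul_zero]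

theorem collapseP_eq_zero_of_mkS (hI : IsGradedIdeal I) {p : P 𝕂 n}
    (hp : mkS I (mkR 𝕂 n p) = 0) : collapseP I p = 0 := by
  refine eq_zero_of_mkS_eq_zero hI ?_ (fun s k e f hf hf' => collapseP_mul_upP hf hf') hp
  intro s i k l
  rw [MvPolynomial.X, MvPolynomial.X, MvPolynomial.monomial_mul, MvPolynomial.monomial_mul,
    one_mul, one_mul]
  refine collapseP_eq_zero (l := l) ?_
  simp [place_add]

/-- The linear map `S → A` which reads the letters of a monomial in the order of their places. -/
def collapse (hI : IsGradedIdeal I) : S I →ₗ[𝕂] A I :=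
  (LinearMap.ker ((mkS I).comp (mkR 𝕂 n)).toLinearMap).liftQ (collapseP I)
    (fun _ hp => collapseP_eq_zero_of_mkS hI hp) ∘ₗ
    (((mkS I).comp (mkR 𝕂 n)).toLinearMap.quotKerEquivOfSurjective
      (mkS_comp_mkR_surjective I)).symm.toLinearMap

variable (hI : IsGradedIdeal I)

theorem collapse_mk (p : P 𝕂 n) : collapse hI (mkS I (mkR 𝕂 n p)) = collapseP I p := by
  have h : (((mkS I).comp (mkR 𝕂 n)).toLinearMap.quotKerEquivOfSurjective
      (mkS_comp_mkR_surjective I)).symm (mkS I (mkR 𝕂 n p)) = Submodule.Quotient.mk p := by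
    rw [LinearEquiv.symm_apply_eq]; rfl
  rw [collapse, LinearMap.comp_apply, LinearEquiv.coe_coe, h]
  rfl

theorem collapse_mono (s : Fin n × ℕ →₀ ℕ) :
    collapse hI (mono I s) = collapseP I (MvPolynomial.monomial s 1) := collapse_mk hI _

/-- A word followed by letters at later places. -/
theorem collapse_up_mul {k e : ℕ} {a : A I} (ha : a ∈ compA I e) (y : S I) :
    collapse hI (up I k a * restrict hI (Set.Ici (k + e)) y) =
      a * collapse hI (restrict hI (Set.Ici (k + e)) y) := by
  induction y using S_induction with
  | mem s =>
    by_cases hs : ∀ l, place s l ≠ 0 → l ∈ Set.Ici (k + e)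
    · rw [restrict_mono_of_forall hI hs]
      rw [compA_eq_span] at ha
      have hs' : ∀ l, l < k + e → place s l = 0 := by
        intro l hl
        by_contra h
        have := hs l h
        rw [Set.mem_Ici] at this
        omega
      induction ha using Submodule.span_induction with
      | mem a ha =>
        obtain ⟨w, rfl, rfl⟩ := ha
        obtain ⟨N, hN⟩ := exists_place_bound s
        rw [up_wordA, ← mono_add, collapse_mono, collapse_mono, add_comm,
          collapseP_add_wordExp (N := N) (fun l _ hl => hs' l hl) (fun l hl => hN l (by omega)),
          collapseP_monomial (s := s) (N := k + w.length + N) (fun l hl => hN l (by omega)),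
          readWord_add, readWord_eq_one I (k := 0) fun l _ hl => hs' l (by omega),
          readWord_eq_one I (k := 0) fun l _ hl => hs' l (by omega), one_mul, one_mul, zero_add]
      | zero => simp
      | add a b _ _ ha hb => simp only [map_add, add_mul, ha, hb]
      | smul c a _ ha => simp only [map_smul, smul_mul_assoc, ha]
    · push Not at hs
      obtain ⟨l, hl, hl'⟩ := hs
      rw [restrict_mono_of_notMem hI hl hl']
      simp
  | zero => simp
  | add y z hy hz => simp only [map_add, mul_add, hy, hz]
  | smul c y hy => simp only [map_smul, mul_smul_comm, hy]

theorem collapse_one : collapse hI 1 = 1 := by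
  rw [← mono_zero, collapse_mono, collapseP_monomial (N := 0) (by simp), readWord_zero]

theorem collapse_up (k : ℕ) (a : A I) : collapse hI (up I k a) = a := by
  have h : collapse hI ∘ₗ up I k = LinearMap.id := by
    refine LinearMap.ext_on_range (span_wordA_eq_top I) fun w => ?_
    have := collapse_up_mul hI (k := k) (wordA_mem_compA I w) 1
    rwa [map_one, mul_one, collapse_one, mul_one] at this
  exact congrArg (fun ℓ => ℓ a) h

include hI in
theorem up_injective (k : ℕ) : Function.Injective (up I k) :=
  Function.LeftInverse.injective (collapse_up hI k)

theorem collapse_mem_compA {e : ℕ} {y : S I} (hy : y ∈ compS I e) :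
    collapse hI y ∈ compA I e := by
  obtain ⟨p, hp, rfl⟩ := hy
  refine (collapse_mk hI p).symm ▸ ?_
  rw [p.as_sum, map_sum]
  refine sum_mem fun s hs => ?_
  have hc : MvPolynomial.monomial s (p.coeff s) =
      p.coeff s • MvPolynomial.monomial s (1 : 𝕂) := by
    rw [MvPolynomial.smul_monomial, smul_eq_mul, mul_one]
  rw [hc, map_smul]
  refine Submodule.smul_mem _ _ ?_
  obtain ⟨N, hN⟩ := exists_place_bound s
  rw [collapseP_monomial hN]
  have hd : e = ∑ l ∈ Finset.range N, place s (0 + l) := by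
    have hp : p.IsHomogeneous e := hp
    have h1 : s.degree = e := by
      rw [← hp (MvPolynomial.mem_support_iff.1 hs), Finsupp.degree_eq_weight_one]; rfl
    rw [← h1, ← Finsupp.degree_mapDomain Prod.snd s, Finsupp.degree]
    simp only [zero_add]
    refine Finset.sum_subset (fun l hl => ?_) fun l _ hl => Finsupp.notMem_support_iff.1 hl
    rw [Finset.mem_range]
    by_contra h
    exact Finsupp.mem_support_iff.1 hl (hN l (by omega))
  rw [hd]
  exact readWord_mem_compA I s 0 N

theorem restrict_Ici_up (k : ℕ) (a : A I) : restrict hI (Set.Ici k) (up I k a) = up I k a := by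
  have h : (restrict hI (Set.Ici k)).toLinearMap ∘ₗ up I k = up I k :=
    LinearMap.ext_on_range (span_wordA_eq_top I) fun w =>
      restrict_up_of_subset hI (fun _ hl _ => hl) (wordA_mem_compA I w)
  exact congrArg (fun ℓ => ℓ a) h

/-- Letters at the places of a word are killed by multiplication with this word. -/
theorem up_mul_restrict {k e : ℕ} {a : A I} (ha : a ∈ compA I e) (y : S I) :
    up I k a * restrict hI (Set.Ici k) y = up I k a * restrict hI (Set.Ici (k + e)) y := by
  rw [compA_eq_span] at ha
  induction ha using Submodule.span_induction with
  | mem a ha =>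
    obtain ⟨w, rfl, rfl⟩ := ha
    rw [up_wordA]
    induction y using S_induction with
    | mem s =>
      by_cases h : ∃ l, place s l ≠ 0 ∧ l < k + w.length
      · obtain ⟨l, hl, hlt⟩ := h
        rw [restrict_mono_of_notMem hI (T := Set.Ici (k + w.length)) hl
          (Set.notMem_Ici.2 hlt), mul_zero]
        by_cases hs : ∀ l, place s l ≠ 0 → l ∈ Set.Ici k
        · rw [restrict_mono_of_forall hI hs, ← mono_add]
          refine mono_eq_zero I (l := l) ?_
          have := Set.mem_Ici.1 (hs l hl)
          rw [place_add, Finsupp.add_apply, place_wordExp, interval_apply, if_pos ⟨this, hlt⟩]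
          omega
        · push Not at hs
          obtain ⟨l', hl', hlt'⟩ := hs
          rw [restrict_mono_of_notMem hI hl' hlt', mul_zero]
      · push Not at h
        rw [restrict_mono_of_forall hI (T := Set.Ici (k + w.length)) h,
          restrict_mono_of_forall hI (T := Set.Ici k)
            fun l hl => Set.mem_Ici.2 ((Nat.le_add_right _ _).trans (h l hl))]
    | zero => simp
    | add y z hy hz => simp only [map_add, mul_add, hy, hz]
    | smul c y hy => simp only [map_smul, mul_smul_comm, hy]
  | zero => simp
  | add a b _ _ ha hb => simp only [map_add, add_mul, ha, hb]
  | smul c a _ ha => simp only [map_smul, smul_mul_assoc, ha]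

end Collapse

-- The expansion holds over every larger finite index set, so that several tensors can share one.
open TensorProduct in
theorem exists_finset_eq_sum_tmul_basis {E E' ι : Type*} [AddCommGroup E] [Module 𝕂 E]
    [AddCommGroup E'] [Module 𝕂 E'] (b : Module.Basis ι 𝕂 E') (z : E ⊗[𝕂] E') :
    ∃ v : Finset ι, ∀ v', v ⊆ v' →
      z = ∑ β ∈ v', TensorProduct.rid 𝕂 E (LinearMap.lTensor E (b.coord β) z) ⊗ₜ[𝕂] b β := by
  classical
  induction z using TensorProduct.induction_on with
  | zero => exact ⟨∅, fun v' _ => by simp⟩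
  | tmul a y =>
    refine ⟨(b.repr y).support, fun v' hv => ?_⟩
    simp only [LinearMap.lTensor_tmul, TensorProduct.rid_tmul, Module.Basis.coord_apply,
      TensorProduct.smul_tmul]
    rw [← TensorProduct.tmul_sum]
    congr 1
    conv_lhs => rw [← b.linearCombination_repr y, Finsupp.linearCombination_apply]
    exact Finset.sum_subset hv fun β _ hβ => by
      rw [Finsupp.notMem_support_iff.1 hβ]; exact zero_smul 𝕂 (b β)
  | add z z' hz hz' =>
    obtain ⟨v, hv⟩ := hz
    obtain ⟨v', hv'⟩ := hz'
    refine ⟨v ∪ v', fun u hu => ?_⟩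
    simp only [map_add, TensorProduct.add_tmul, Finset.sum_add_distrib]
    rw [← hv u (Finset.union_subset_left hu), ← hv' u (Finset.union_subset_right hu)]

/-! ### Separating a monomial at an empty place -/

section Split

open TensorProduct

variable {I : Ideal (F 𝕂 n)} (hI : IsGradedIdeal I)

-- The inclusions at adjacent places differ only for `m - 1` and `m`, and the factor at `m` is zero.
variable (I) in
theorem twistCompat_split (m : ℕ) :
    TwistCompat (I := I) (C := S I ⊗[𝕂] S I) (fun l => if l = m then 0 else 1)
      (fun l => if l < m then Algebra.TensorProduct.includeLeft
        else Algebra.TensorProduct.includeRight) := by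
  intro l
  rcases lt_trichotomy l m with h | h | h
  · by_cases h' : l + 1 = m
    · exact Or.inr (Or.inl (if_pos h'))
    · refine Or.inr (Or.inr ?_)
      beta_reduce
      rw [if_pos h, if_pos (by omega)]
  · exact Or.inl (if_pos h)
  · refine Or.inr (Or.inr ?_)
    beta_reduce
    rw [if_neg (by omega), if_neg (by omega)]

/-- The homomorphism `S → S ⊗ S` which kills the place `m` and separates the places before `m`
from those after `m`. -/
def split (m : ℕ) : S I →ₐ[𝕂] S I ⊗[𝕂] S I := twist hI _ _ (twistCompat_split I m)

theorem split_mono_left {m : ℕ} {s : Fin n × ℕ →₀ ℕ} (h : ∀ l, place s l ≠ 0 → l < m) :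
    split hI m (mono I s) = mono I s ⊗ₜ 1 := by
  refine algHom_mono_eq (C := S I ⊗[𝕂] S I)
    (g := Algebra.TensorProduct.includeLeft) fun l hl k => ?_
  have := h l hl
  rw [split, twist_x, if_neg (by omega), if_pos this, one_mul]

theorem split_mono_right {m : ℕ} {s : Fin n × ℕ →₀ ℕ} (h : ∀ l, place s l ≠ 0 → m < l) :
    split hI m (mono I s) = 1 ⊗ₜ mono I s := by
  refine algHom_mono_eq (C := S I ⊗[𝕂] S I)
    (g := Algebra.TensorProduct.includeRight) fun l hl k => ?_
  have := h l hl
  rw [split, twist_x, if_neg (by omega), if_neg (by omega), one_mul]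

variable [I.IsTwoSided]

/-- The linear map `S → A ⊗ S` which kills the place `m` and reads the letters before it. -/
def splitRead (m : ℕ) : S I →ₗ[𝕂] A I ⊗[𝕂] S I :=
  LinearMap.rTensor (S I) (collapse hI) ∘ₗ (split hI m).toLinearMap

theorem splitRead_wordExp_add {m k : ℕ} {w : List (Fin n)} (hw : k + w.length ≤ m)
    {t : Fin n × ℕ →₀ ℕ} (ht : ∀ l, place t l ≠ 0 → m < l) :
    splitRead hI m (mono I (wordExp k w + t)) = wordA I w ⊗ₜ mono I t := by
  have h : ∀ l, place (wordExp k w) l ≠ 0 → l < m := by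
    intro l hl
    rw [place_wordExp, interval_apply] at hl
    split_ifs at hl
    · omega
    · exact absurd rfl hl
  rw [splitRead, LinearMap.comp_apply, AlgHom.toLinearMap_apply, mono_add, map_mul,
    split_mono_left hI h, split_mono_right hI ht, Algebra.TensorProduct.tmul_mul_tmul, mul_one,
    one_mul, LinearMap.rTensor_tmul, ← up_wordA, collapse_up]

variable (I) in
/-- The linear map `A ⊗ S → S` which puts the letters of the first factor in consecutive places,
starting from the place `k`. -/
def recombine (k : ℕ) : A I ⊗[𝕂] S I →ₗ[𝕂] S I :=
  TensorProduct.lift (LinearMap.mul 𝕂 (S I) ∘ₗ up I k)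

theorem recombine_tmul (k : ℕ) (a : A I) (y : S I) : recombine I k (a ⊗ₜ y) = up I k a * y := rfl

variable (I) in
/-- The span of the monomials which are products of a word placed in `[k, k + e)` and of a monomial
of multidegree `V`. -/
def blockSpan (k e : ℕ) (V : ℕ →₀ ℕ) : Submodule 𝕂 (S I) :=
  Submodule.span 𝕂 (mono I '' {s | ∃ w t, w.length = e ∧ place t = V ∧ s = wordExp k w + t})

variable {k e m : ℕ} {V : ℕ →₀ ℕ} {y : S I}

theorem recombine_splitRead (hm : k + e ≤ m) (hV : ∀ l, V l ≠ 0 → m < l)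
    (hy : y ∈ blockSpan I k e V) : recombine I k (splitRead hI m y) = y := by
  induction hy using Submodule.span_induction with
  | mem y hy =>
    obtain ⟨_, ⟨w, t, rfl, rfl, rfl⟩, rfl⟩ := hy
    rw [splitRead_wordExp_add hI hm hV, recombine_tmul, up_wordA, mono_add]
  | zero => rw [map_zero, map_zero]
  | add y z _ _ hy hz => rw [map_add, map_add, hy, hz]
  | smul c y _ hy => rw [map_smul, map_smul, hy]

/-- The letters of `c` fill `[0, k)`, directly before the block, so reading concatenates them with
it. -/
theorem splitRead_up_mul (hm : k + e ≤ m) (hV : ∀ l, V l ≠ 0 → m < l)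
    (hy : y ∈ blockSpan I k e V) {c : A I} (hc : c ∈ compA I k) :
    splitRead hI m (up I 0 c * y) =
      LinearMap.rTensor (S I) (LinearMap.mulLeft 𝕂 c) (splitRead hI m y) := by
  induction hy using Submodule.span_induction with
  | mem y hy =>
    obtain ⟨_, ⟨w, t, rfl, rfl, rfl⟩, rfl⟩ := hy
    rw [splitRead_wordExp_add hI hm hV, LinearMap.rTensor_tmul, LinearMap.mulLeft_apply]
    rw [compA_eq_span] at hc
    induction hc using Submodule.span_induction with
    | mem c hc =>
      obtain ⟨u, rfl, rfl⟩ := hc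
      have h := wordExp_append 0 u w
      rw [zero_add] at h
      rw [up_wordA, ← mono_add, ← add_assoc, ← h, splitRead_wordExp_add hI ?_ hV, wordA_append]
      rw [List.length_append, zero_add]
      exact hm
    | zero => simp
    | add c c' _ _ hc hc' => simp only [map_add, add_mul, TensorProduct.add_tmul, hc, hc']
    | smul a c _ hc => simp only [map_smul, smul_mul_assoc, TensorProduct.smul_tmul', hc]
  | zero => simp
  | add y z _ _ hy hz => rw [mul_add, map_add, map_add, map_add, hy, hz]
  | smul c y _ hy => rw [mul_smul_comm, map_smul, map_smul, map_smul, hy]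

variable (I) in
/-- The contraction `A ⊗ S → A` with a linear functional on `S`. -/
def contract (ℓ : S I →ₗ[𝕂] 𝕂) : A I ⊗[𝕂] S I →ₗ[𝕂] A I :=
  (TensorProduct.rid 𝕂 (A I)).toLinearMap ∘ₗ LinearMap.lTensor (A I) ℓ

omit [I.IsTwoSided] in
theorem contract_tmul (ℓ : S I →ₗ[𝕂] 𝕂) (a : A I) (y : S I) :
    contract I ℓ (a ⊗ₜ y) = ℓ y • a := by
  simp [contract]

theorem contract_rTensor_mulLeft (ℓ : S I →ₗ[𝕂] 𝕂) (c : A I) (z : A I ⊗[𝕂] S I) :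
    contract I ℓ (LinearMap.rTensor (S I) (LinearMap.mulLeft 𝕂 c) z) = c * contract I ℓ z := by
  induction z using TensorProduct.induction_on with
  | zero => simp
  | tmul a y =>
    rw [LinearMap.rTensor_tmul, contract_tmul, contract_tmul, LinearMap.mulLeft_apply,
      mul_smul_comm]
  | add z z' hz hz' => rw [map_add, map_add, map_add, hz, hz', mul_add]

theorem contract_splitRead_mem (hm : k + e ≤ m) (hV : ∀ l, V l ≠ 0 → m < l)
    (hy : y ∈ blockSpan I k e V) (ℓ : S I →ₗ[𝕂] 𝕂) :
    contract I ℓ (splitRead hI m y) ∈ compA I e := by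
  induction hy using Submodule.span_induction with
  | mem y hy =>
    obtain ⟨_, ⟨w, t, rfl, rfl, rfl⟩, rfl⟩ := hy
    rw [splitRead_wordExp_add hI hm hV, contract_tmul]
    exact Submodule.smul_mem _ _ (wordA_mem_compA I w)
  | zero => rw [map_zero, map_zero]; exact zero_mem _
  | add y z _ _ hy hz => rw [map_add, map_add]; exact add_mem hy hz
  | smul c y _ hy => rw [map_smul, map_smul]; exact Submodule.smul_mem _ _ hy

end Split

/-! ### Generators of the full syzygy module `K'` -/

section Syzygies

variable {I : Ideal (F 𝕂 n)} [I.IsTwoSided] {r s : ℕ}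

theorem mem_K_iff {g : Fin s → Fin r → A I} {f : Fin s → A I} :
    f ∈ K I g ↔ ∀ i, ∑ j, g j i * f j = 0 :=
  LinearMap.mem_ker.trans funext_iff

theorem mem_K'_iff {g : Fin s → Fin r → A I} {f : Fin s → S I} :
    f ∈ K' I (fun j => iota I (fun _ => 0) (g j)) ↔ ∀ i, ∑ j, up I 0 (g j i) * f j = 0 := by
  rw [K', LinearMap.mem_ker, funext_iff]
  refine forall_congr' fun i => ?_
  rw [phi', Fintype.linearCombination_apply, Finset.sum_apply]
  simp only [Pi.smul_apply, smul_eq_mul, iota_apply, mul_comm, Pi.zero_apply]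

theorem IsHomogeneousVec.apply_mem_compA {d : ℕ} {v : Fin r → A I}
    (h : IsHomogeneousVec (compA I) (fun _ => 0) d v) (i : Fin r) : v i ∈ compA I d := by
  rcases h i with h | ⟨e, he, h⟩
  · rw [h]; exact zero_mem _
  · rw [zero_add] at he
    exact he ▸ h

/-- The map `ι` maps syzygies to syzygies, and reflects them. -/
theorem iota_mem_K'_iff (hI : IsGradedIdeal I) {g : Fin s → Fin r → A I} {Δ : Fin s → ℕ}
    (hg : ∀ j i, g j i ∈ compA I (Δ j)) {f : Fin s → A I} :
    iota I Δ f ∈ K' I (fun j => iota I (fun _ => 0) (g j)) ↔ f ∈ K I g := by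
  rw [mem_K'_iff, mem_K_iff]
  refine forall_congr' fun i => ?_
  have h : ∑ j, up I 0 (g j i) * iota I Δ f j = up I 0 (∑ j, g j i * f j) := by
    rw [map_sum]
    refine Finset.sum_congr rfl fun j _ => ?_
    rw [← up_mul_up (hg j i), zero_add, iota_apply]
  rw [h, map_eq_zero_iff _ (up_injective hI 0)]

/-- The images under `ι` of the homogeneous syzygies of degree `m`. -/
def syzygyImage (g : Fin s → Fin r → A I) (Δ : Fin s → ℕ) (m : ℕ) : Set (Fin s → S I) :=
  iota I Δ '' {f | f ∈ K I g ∧ IsHomogeneousVec (compA I) Δ m f}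

/-- Syzygies whose components start with words ending just before the empty place `m`. -/
theorem mem_span_syzygyImage_of_blockSpan (hI : IsGradedIdeal I) {g : Fin s → Fin r → A I}
    {Δ : Fin s → ℕ} (hg : ∀ j i, g j i ∈ compA I (Δ j)) {h : Fin s → S I}
    (hK : h ∈ K' I (fun j => iota I (fun _ => 0) (g j))) {m : ℕ} {V : ℕ →₀ ℕ}
    (hV : ∀ l, V l ≠ 0 → m < l)
    (hh : ∀ j, h j = 0 ∨ ∃ e, Δ j + e = m ∧ h j ∈ blockSpan I (Δ j) e V) :
    h ∈ Submodule.span (S I) (syzygyImage g Δ m) := by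
  classical
  let b := Module.Basis.ofVectorSpace 𝕂 (S I)
  choose v hv using fun j => exists_finset_eq_sum_tmul_basis b (splitRead hI m (h j))
  let u := Finset.univ.biUnion v
  -- The coefficients of one basis element `b β`, taken in all coordinates, form the candidate
  -- syzygy over `A`.
  let f : Module.Basis.ofVectorSpaceIndex 𝕂 (S I) → Fin s → A I :=
    fun β j => contract I (b.coord β) (splitRead hI m (h j))
  have hsum : h = ∑ β ∈ u, b β • iota I Δ (f β) := by
    funext j
    rw [Finset.sum_apply]
    have h1 := congrArg (recombine I (Δ j))
      (hv j u (Finset.subset_biUnion_of_mem v (Finset.mem_univ j)))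
    have h2 : recombine I (Δ j) (splitRead hI m (h j)) = h j := by
      rcases hh j with h0 | ⟨e, he, hj⟩
      · rw [h0, map_zero, map_zero]
      · exact recombine_splitRead hI he.le hV hj
    rw [h2, map_sum] at h1
    rw [h1]
    refine Finset.sum_congr rfl fun β _ => ?_
    rw [recombine_tmul, Pi.smul_apply, smul_eq_mul, iota_apply, mul_comm]
    rfl
  rw [hsum]
  refine sum_mem fun β _ => Submodule.smul_mem _ _ (Submodule.subset_span ⟨f β, ⟨?_, ?_⟩, rfl⟩)
  · rw [mem_K_iff]
    intro i
    rw [mem_K'_iff] at hK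
    -- Reading turns multiplication by `g'_j` into left multiplication by `g_j`, and contraction
    -- commutes with that; so the relation for `h` becomes the relation for `f β`.
    have h0 : contract I (b.coord β) (splitRead hI m (∑ j, up I 0 (g j i) * h j)) = 0 := by
      rw [hK i, map_zero, map_zero]
    rw [← h0, map_sum, map_sum]
    refine Finset.sum_congr rfl fun j _ => ?_
    rcases hh j with hj | ⟨e, he, hj⟩
    · simp [f, hj]
    · rw [splitRead_up_mul hI he.le hV hj (hg j i), contract_rTensor_mulLeft]
  · intro j
    rcases hh j with hj | ⟨e, he, hj⟩
    · left
      simp [f, hj]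
    · exact Or.inr ⟨e, he, contract_splitRead_mem hI he.le hV hj _⟩

omit [I.IsTwoSided] in
theorem single_mem_span_B {Δ : Fin s → ℕ} {j : Fin s} {l : ℕ} (hl : l < Δ j) {y : S I}
    {U : Set (Fin n × ℕ →₀ ℕ)} (hU : ∀ t ∈ U, place t l ≠ 0)
    (hy : y ∈ Submodule.span 𝕂 (mono I '' U)) :
    Pi.single j y ∈ Submodule.span (S I) (B I Δ) := by
  induction hy using Submodule.span_induction with
  | mem y hy =>
    obtain ⟨t, ht, rfl⟩ := hy
    obtain ⟨k, t, rfl⟩ := exists_eq_single_add (hU t ht)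
    rw [mono_add, mono_single, mul_comm, ← smul_eq_mul, Pi.single_smul]
    exact Submodule.smul_mem _ _ (Submodule.subset_span ⟨j, k, l, hl, rfl⟩)
  | zero => rw [Pi.single_zero]; exact zero_mem _
  | add y z _ _ hy hz => rw [Pi.single_add]; exact add_mem hy hz
  | smul c y _ hy =>
    rw [Algebra.smul_def, ← smul_eq_mul, Pi.single_smul]
    exact Submodule.smul_mem _ _ hy

/-- Multihomogeneous syzygies are generated by `B` and by the image of `ι`. -/
theorem mem_span_of_multihomogeneous (hI : IsGradedIdeal I) {g : Fin s → Fin r → A I}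
    {Δ : Fin s → ℕ} (hg : ∀ j i, g j i ∈ compA I (Δ j)) {h : Fin s → S I}
    (hK : h ∈ K' I (fun j => iota I (fun _ => 0) (g j))) (U : ℕ →₀ ℕ)
    (hU : ∀ j, h j ∈ Submodule.span 𝕂 (mono I '' {t | interval 0 (Δ j) + place t = U})) :
    h ∈ Submodule.span (S I) (B I Δ ∪ ⋃ m, syzygyImage g Δ m) := by
  by_cases hsq : ∃ l, 2 ≤ U l
  · obtain ⟨l, hl⟩ := hsq
    rw [← Finset.univ_sum_single h]
    refine Submodule.span_mono Set.subset_union_left (sum_mem fun j _ => ?_)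
    by_cases hj : l < Δ j
    · refine single_mem_span_B hj (fun t ht => ?_) (hU j)
      have := DFunLike.congr_fun ht l
      rw [Finsupp.add_apply, interval_apply, if_pos (by omega)] at this
      omega
    -- Here `ε'_j` does not reach the place `l`, so the monomials themselves carry two letters
    -- there.
    · have h0 : h j = 0 := by
        have hle : Submodule.span 𝕂 (mono I '' {t | interval 0 (Δ j) + place t = U}) ≤ ⊥ := by
          refine Submodule.span_le.2 ?_
          rintro _ ⟨t, ht, rfl⟩
          refine mono_eq_zero I (l := l) ?_
          have := DFunLike.congr_fun ht l
          rw [Finsupp.add_apply, interval_apply, if_neg (by omega)] at this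
          omega
        exact hle (hU j)
      rw [h0, Pi.single_zero]
      exact zero_mem _
  · push Not at hsq
    have hex : ∃ m, U m = 0 := by
      obtain ⟨m, hm⟩ := Infinite.exists_notMem_finset U.support
      exact ⟨m, Finsupp.notMem_support_iff.1 hm⟩
    classical
    -- The first empty place: everything before it is filled exactly once.
    let m := Nat.find hex
    have hm : U m = 0 := Nat.find_spec hex
    have hlt : ∀ l, l < m → U l ≠ 0 := fun l hl => Nat.find_min hex hl
    let V : ℕ →₀ ℕ := U.filter (m < ·)
    have hUV : U = interval 0 m + V := by
      ext l
      rw [Finsupp.add_apply, interval_apply, Finsupp.filter_apply]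
      have h1 := hsq l
      rcases lt_trichotomy l m with h | h | h
      · have := hlt l h
        rw [if_pos (by omega), if_neg (by omega)]
        omega
      · rw [if_neg (by omega), if_neg (by omega), h, hm, add_zero]
      · rw [if_neg (by omega), if_pos h, zero_add]
    refine Submodule.span_mono
      ((Set.subset_iUnion (syzygyImage g Δ) m).trans Set.subset_union_right)
      (mem_span_syzygyImage_of_blockSpan hI hg hK (V := V) ?_ ?_)
    · intro l hl
      by_contra h
      exact hl (Finsupp.filter_apply_neg _ _ h)
    · intro j
      by_cases hj : Δ j ≤ m
      · obtain ⟨e, he⟩ := Nat.exists_eq_add_of_le hj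
        refine Or.inr ⟨e, he.symm, Submodule.span_mono (Set.image_mono ?_) (hU j)⟩
        intro t ht
        have ht : interval 0 (Δ j) + place t = U := ht
        rw [hUV, he, interval_add, zero_add, add_assoc] at ht
        exact exists_eq_wordExp_add e (Δ j) V t (add_left_cancel ht)
      -- The interval `[0, Δ_j)` contains `m`, where `U` vanishes: no monomial is available.
      · left
        have hle : Submodule.span 𝕂 (mono I '' {t | interval 0 (Δ j) + place t = U}) ≤ ⊥ := by
          refine Submodule.span_le.2 ?_
          rintro _ ⟨t, ht, rfl⟩
          have := DFunLike.congr_fun ht m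
          rw [Finsupp.add_apply, interval_apply, if_pos (by omega), hm] at this
          omega
        exact hle (hU j)

/-- The syzygy module `K'` is generated by `B` and by the images of the homogeneous elements
of `K`. -/
theorem K'_le_span (hI : IsGradedIdeal I) {g : Fin s → Fin r → A I} {Δ : Fin s → ℕ}
    (hg : ∀ j i, g j i ∈ compA I (Δ j)) :
    K' I (fun j => iota I (fun _ => 0) (g j)) ≤
      Submodule.span (S I) (B I Δ ∪ ⋃ m, syzygyImage g Δ m) := by
  classical
  intro f hf
  let q : Fin s → MvPolynomial ℕ (S I) :=
    fun j => MvPolynomial.monomial (interval 0 (Δ j)) 1 * coaction hI (f j)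
  let u := Finset.univ.biUnion fun j => (q j).support
  have hsum : f = ∑ U ∈ u, fun j => (q j).coeff U := by
    funext j
    rw [Finset.sum_apply]
    have h1 : MvPolynomial.eval (fun _ => 1) (q j) = f j := by
      rw [map_mul, eval_one_coaction, MvPolynomial.eval_monomial]
      simp
    rw [← h1, MvPolynomial.eval_eq]
    simp only [one_pow, Finset.prod_const_one, mul_one]
    exact Finset.sum_subset
      (Finset.subset_biUnion_of_mem (fun j => (q j).support) (Finset.mem_univ j))
      fun U _ hU => MvPolynomial.notMem_support_iff.1 hU
  rw [hsum]
  refine sum_mem fun U _ => mem_span_of_multihomogeneous hI hg ?_ U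
    fun j => coeff_coaction_mem hI _ U (f j)
  rw [mem_K'_iff] at hf ⊢
  intro i
  -- Since `g'_j` is multihomogeneous, the `U`-coefficient of the relation is the relation between
  -- the `U`-coefficients.
  have h0 := congrArg (fun y => MvPolynomial.coeff U (coaction hI y)) (hf i)
  simp only [map_sum, map_mul, map_zero, MvPolynomial.coeff_zero, MvPolynomial.coeff_sum] at h0
  rw [← h0]
  refine Finset.sum_congr rfl fun j _ => ?_
  rw [coaction_up hI (hg j i), ← MvPolynomial.coeff_C_mul, ← mul_assoc,
    MvPolynomial.C_mul_monomial, mul_one]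

end Syzygies

/-! ### Irredundant generators and finiteness over `S(d)` -/

/-- A finitely generated module spanned by `X ∪ Y` is spanned by `X` and by a subset of `Y` no
element of which is redundant. -/
theorem exists_subset_irredundant {T E : Type*} [Ring T] [AddCommGroup E] [Module T E]
    {N : Submodule T E} (hN : N.FG) {X Y : Set E} (h : Submodule.span T (X ∪ Y) = N) :
    ∃ Y' ⊆ Y, Submodule.span T (X ∪ Y') = N ∧
      ∀ y ∈ Y', y ∉ Submodule.span T ((X ∪ Y') \ {y}) := by
  classical
  have hex : ∃ k, ∃ u : Finset E, u.card = k ∧ ↑u ⊆ Y ∧ Submodule.span T (X ∪ ↑u) = N := by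
    obtain ⟨t, ht⟩ := hN
    obtain ⟨u, hu, htu⟩ := Submodule.subset_span_finite_of_subset_span (t := t)
      (show (t : Set E) ⊆ Submodule.span T (X ∪ Y) by
        rw [h, ← ht]; exact Submodule.subset_span)
    refine ⟨_, u.filter (· ∈ Y), rfl, fun y hy => (Finset.mem_filter.1 hy).2, le_antisymm ?_ ?_⟩
    · rw [← h]
      refine Submodule.span_mono (Set.union_subset_union_right X fun y hy => ?_)
      exact (Finset.mem_filter.1 hy).2
    · rw [← ht]
      refine Submodule.span_le.2 (htu.trans (Submodule.span_mono fun y hy => ?_))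
      by_cases hyY : y ∈ Y
      · exact Or.inr (Finset.mem_filter.2 ⟨hy, hyY⟩)
      · exact Or.inl ((hu hy).resolve_right hyY)
  -- Take `u` of least cardinality: dropping a redundant element would give a smaller one.
  obtain ⟨u, hcard, hu, hspan⟩ := Nat.find_spec hex
  refine ⟨u, hu, hspan, fun y hy hy' => ?_⟩
  have hlt : (u.erase y).card < Nat.find hex := hcard ▸ Finset.card_erase_lt_of_mem hy
  refine Nat.find_min hex hlt ⟨_, rfl, (Finset.coe_subset.2 (Finset.erase_subset y u)).trans hu, ?_⟩
  have hsub : (X ∪ ↑u) \ {y} ⊆ X ∪ ↑(u.erase y) := by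
    rintro z ⟨hz | hz, hzy⟩
    · exact Or.inl hz
    · exact Or.inr (Finset.mem_erase.2 ⟨hzy, hz⟩)
  refine le_antisymm ?_ ?_
  · rw [← hspan]
    exact Submodule.span_mono (Set.union_subset_union_right X
      (Finset.coe_subset.2 (Finset.erase_subset y u)))
  · rw [← hspan]
    refine Submodule.span_le.2 ?_
    rintro z hz
    by_cases hzy : z = y
    · rw [hzy]
      exact Submodule.span_mono hsub hy'
    · exact Submodule.subset_span (hsub ⟨hz, hzy⟩)

variable {I : Ideal (F 𝕂 n)}

instance Strunc.isNoetherianRing (d : ℕ) : IsNoetherianRing (Strunc I d) := by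
  refine Algebra.FiniteType.isNoetherianRing 𝕂 _ (h := ?_)
  rw [← Subalgebra.fg_iff_finiteType]
  refine Subalgebra.fg_def.2 ⟨_, ?_, rfl⟩
  refine (Set.finite_range fun p : Fin n × Fin d => x I p.1 p.2).subset ?_
  rintro _ ⟨k, l, hl, rfl⟩
  exact ⟨(k, ⟨l, hl⟩), rfl⟩

/-- The module lies in the image of `S(d)^s`, which is Noetherian. -/
theorem Ktrunc_fg {r s : ℕ} (g' : Fin s → Fin r → S I) (d : ℕ) : (Ktrunc I g' d).FG := by
  have h : IsNoetherian (Strunc I d)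
      (LinearMap.range ((Algebra.linearMap (Strunc I d) (S I)).compLeft (Fin s))) := inferInstance
  refine isNoetherian_submodule.1 h _ fun f hf => ?_
  exact ⟨fun j => ⟨f j, hf.2 j⟩, rfl⟩

/-! ### Truncated syzygies, irredundance and transport along `ι` -/

variable [I.IsTwoSided] {r s d : ℕ} {g : Fin s → Fin r → A I} {Δ : Fin s → ℕ}

theorem compA_zero_le : compA I 0 ≤ Submodule.span 𝕂 {1} := by
  rw [compA_eq_span]
  refine Submodule.span_mono ?_
  rintro _ ⟨w, hw, rfl⟩
  rw [List.length_eq_zero_iff.1 hw, wordA_nil]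
  rfl

/-- By minimality of `g`, no component of a homogeneous syzygy is a nonzero scalar. -/
theorem syzygy_apply_eq_zero (hinj : Function.Injective g)
    (hirr : ∀ v ∈ Set.range g, v ∉ Submodule.span (A I)ᵐᵒᵖ (Set.range g \ {v}))
    {f : Fin s → A I} (hf : f ∈ K I g) {j : Fin s} (hj : f j ∈ compA I 0) : f j = 0 := by
  classical
  obtain ⟨c, hc⟩ := Submodule.mem_span_singleton.1 (compA_zero_le hj)
  by_contra h0
  have hc0 : c ≠ 0 := by
    rintro rfl
    exact h0 (by rw [← hc, zero_smul])
  refine hirr (g j) ⟨j, rfl⟩ ?_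
  -- The scalar is invertible, so the relation can be solved for `g j`.
  have hsum : g j = ∑ k ∈ Finset.univ.erase j, MulOpposite.op (-c⁻¹ • f k) • g k := by
    funext i
    have h1 := mem_K_iff.1 hf i
    rw [← Finset.add_sum_erase _ _ (Finset.mem_univ j), ← hc, mul_smul_comm, mul_one] at h1
    rw [Finset.sum_apply]
    simp only [Pi.smul_apply, MulOpposite.smul_eq_mul_unop, MulOpposite.unop_op, mul_smul_comm]
    rw [← Finset.smul_sum, ← neg_eq_of_add_eq_zero_right h1, smul_neg, neg_smul, neg_neg,
      smul_smul, inv_mul_cancel₀ hc0, one_smul]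
  have hmem : ∑ k ∈ Finset.univ.erase j, MulOpposite.op (-c⁻¹ • f k) • g k ∈
      Submodule.span (A I)ᵐᵒᵖ (Set.range g \ {g j}) := by
    refine sum_mem fun k hk => Submodule.smul_mem _ _ (Submodule.subset_span ⟨⟨k, rfl⟩, ?_⟩)
    exact fun h => (Finset.mem_erase.1 hk).1 (hinj h)
  rwa [← hsum] at hmem

/-- The components of a homogeneous syzygy have positive degree. -/
theorem syzygy_apply_eq_zero_or (hinj : Function.Injective g)
    (hirr : ∀ v ∈ Set.range g, v ∉ Submodule.span (A I)ᵐᵒᵖ (Set.range g \ {v}))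
    {f : Fin s → A I} (hf : f ∈ K I g) {m : ℕ} (hm : IsHomogeneousVec (compA I) Δ m f)
    (j : Fin s) : f j = 0 ∨ ∃ e, Δ j + (e + 1) = m ∧ f j ∈ compA I (e + 1) := by
  rcases hm j with h | ⟨_ | e, he, h⟩
  · exact Or.inl h
  · exact Or.inl (syzygy_apply_eq_zero hinj hirr hf h)
  · exact Or.inr ⟨e, he, h⟩

/-- Every place occurring in `B` is one of the first `d` places. -/
theorem degree_le (hI : IsGradedIdeal I)
    (hirr : ∀ v ∈ Set.range g, v ∉ Submodule.span (A I)ᵐᵒᵖ (Set.range g \ {v}))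
    (hg : ∀ j i, g j i ∈ compA I (Δ j))
    (hB : ∀ b ∈ B I Δ, ∀ j, b j ∈ Strunc I d) (hB0 : ∀ b ∈ B I Δ, b ≠ 0) (j : Fin s) :
    Δ j ≤ d := by
  by_contra! hlt
  rcases n.eq_zero_or_pos with rfl | hn
  -- Without letters `A` vanishes in positive degrees, so `g j = 0`, which is always redundant.
  · refine hirr (g j) ⟨j, rfl⟩ ?_
    have h0 : g j = 0 := by
      funext i
      have h := hg j i
      have hle : compA I (Δ j) ≤ ⊥ := by
        rw [compA_eq_span]
        refine Submodule.span_le.2 ?_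
        rintro _ ⟨_ | ⟨a, w⟩, hw, rfl⟩
        · exact absurd hw (by simp only [List.length_nil, Set.mem_ofPred_eq]; omega)
        · exact a.elim0
      exact hle h
    rw [h0]
    exact zero_mem _
  · have hb : Pi.single j (x I ⟨0, hn⟩ d) ∈ B I Δ := ⟨j, ⟨0, hn⟩, d, hlt, rfl⟩
    refine hB0 _ hb ?_
    have h1 := hB _ hb j
    rw [Pi.single_eq_same] at h1
    have h2 := restrict_of_mem_Strunc hI h1
    rw [restrict_x_of_notMem hI (Set.notMem_Iio.2 le_rfl)] at h2
    rw [← h2, Pi.single_zero]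

theorem iota_apply_mem_Strunc {m : ℕ} (hm : m ≤ d)
    {f : Fin s → A I} (hf : IsHomogeneousVec (compA I) Δ m f) (j : Fin s) :
    iota I Δ f j ∈ Strunc I d := by
  rw [iota_apply]
  rcases hf j with h | ⟨e, he, h⟩
  · rw [h, map_zero]; exact zero_mem _
  · exact up_mem_Strunc (he.trans_le hm) h

theorem iota_homogeneous {m : ℕ} {f : Fin s → A I} (hf : IsHomogeneousVec (compA I) Δ m f) :
    IsHomogeneousVec (compS I) Δ m (iota I Δ f) := by
  intro j
  rw [iota_apply]
  rcases hf j with h | ⟨e, he, h⟩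
  · left; rw [h, map_zero]
  · exact Or.inr ⟨e, he, up_mem_compS I h _⟩

/-- `collapse` preserves degree and undoes each coordinate of `ι`. -/
theorem homogeneous_of_iota (hI : IsGradedIdeal I) {m : ℕ} {f : Fin s → A I}
    (hf : IsHomogeneousVec (compS I) Δ m (iota I Δ f)) : IsHomogeneousVec (compA I) Δ m f := by
  intro j
  rcases hf j with h | ⟨e, he, h⟩
  · left
    rw [iota_apply] at h
    exact (map_eq_zero_iff _ (up_injective hI _)).1 h
  · refine Or.inr ⟨e, he, ?_⟩
    rw [iota_apply] at h
    rw [← collapse_up hI (Δ j) (f j)]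
    exact collapse_mem_compA hI h

theorem iota_injective (hI : IsGradedIdeal I) : Function.Injective (iota I Δ) := by
  intro f f' h
  funext j
  have := congrFun h j
  rw [iota_apply, iota_apply] at this
  exact up_injective hI _ this

theorem syzygyImage_subset_Ktrunc (hI : IsGradedIdeal I) (hg : ∀ j i, g j i ∈ compA I (Δ j))
    {m : ℕ} (hm : m ≤ d) :
    syzygyImage g Δ m ⊆ Ktrunc I (fun j => iota I (fun _ => 0) (g j)) d := by
  rintro _ ⟨f, ⟨hf, hfm⟩, rfl⟩
  exact ⟨(iota_mem_K'_iff hI hg).2 hf, iota_apply_mem_Strunc hm hfm⟩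

/-- The truncated syzygy module is generated by `B` and by the images of the homogeneous syzygies
of degree at most `d`. -/
theorem Ktrunc_le_span (hI : IsGradedIdeal I) (hinj : Function.Injective g)
    (hirr : ∀ v ∈ Set.range g, v ∉ Submodule.span (A I)ᵐᵒᵖ (Set.range g \ {v}))
    (hg : ∀ j i, g j i ∈ compA I (Δ j)) (hΔ : ∀ j, Δ j ≤ d) :
    Ktrunc I (fun j => iota I (fun _ => 0) (g j)) d ≤
      Submodule.span (Strunc I d) (B I Δ ∪ ⋃ m ≤ d, syzygyImage g Δ m) := by
  intro f hf
  -- The retraction onto `S(d)` is applied to a combination over `S`.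
  have key : ∀ y ∈ Submodule.span (S I) (B I Δ ∪ ⋃ m, syzygyImage g Δ m),
      (fun j => restrict hI (Set.Iio d) (y j)) ∈
        Submodule.span (Strunc I d) (B I Δ ∪ ⋃ m ≤ d, syzygyImage g Δ m) := by
    intro y hy
    induction hy using Submodule.span_induction with
    | mem y hy =>
      rcases hy with hy | hy
      · refine Submodule.subset_span (Or.inl ?_)
        obtain ⟨j, k, l, hl, rfl⟩ := hy
        refine ⟨j, k, l, hl, ?_⟩
        funext j'
        rw [Pi.apply_single (fun _ => restrict hI (Set.Iio d)) (fun _ => map_zero _),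
          restrict_x_of_mem hI (Set.mem_Iio.2 (hl.trans_le (hΔ j)))]
      · obtain ⟨m, hm⟩ := Set.mem_iUnion.1 hy
        obtain ⟨f, ⟨hfK, hfm⟩, rfl⟩ := hm
        by_cases hmd : m ≤ d
        · have heq : (fun j => restrict hI (Set.Iio d) (iota I Δ f j)) = iota I Δ f :=
            funext fun j => restrict_of_mem_Strunc hI (iota_apply_mem_Strunc hmd hfm j)
          rw [heq]
          exact Submodule.subset_span (Or.inr (Set.mem_iUnion₂.2 ⟨m, hmd, f, ⟨hfK, hfm⟩, rfl⟩))
        -- For `m > d`, a nonzero component has positive degree, so its words occupy the place `m -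
        -- 1 ≥ d`.
        · have heq : (fun j => restrict hI (Set.Iio d) (iota I Δ f j)) = 0 := by
            funext j
            rw [iota_apply]
            rcases syzygy_apply_eq_zero_or hinj hirr hfK hfm j with h | ⟨e, he, h⟩
            · rw [h, map_zero, map_zero]; rfl
            · exact restrict_up_eq_zero hI (l := Δ j + e) (by omega) (by omega)
                (Set.notMem_Iio.2 (by omega)) h
          rw [heq]
          exact zero_mem _
    | zero =>
      simp only [Pi.zero_apply, map_zero]
      exact zero_mem _
    | add y z _ _ hy hz =>
      simp only [Pi.add_apply, map_add]
      exact add_mem hy hz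
    | smul a y _ hy =>
      simp only [Pi.smul_apply, smul_eq_mul, map_mul]
      exact Submodule.smul_mem _ (⟨_, restrict_mem_Strunc hI d a⟩ : Strunc I d) hy
  have h := key f (K'_le_span hI hg hf.1)
  rwa [show (fun j => restrict hI (Set.Iio d) (f j)) = f from
    funext fun j => restrict_of_mem_Strunc hI (hf.2 j)] at h

/-- The elements of `B` stay irredundant when images of syzygies are added. -/
theorem B_irredundant (hI : IsGradedIdeal I) (hinj : Function.Injective g)
    (hirr : ∀ v ∈ Set.range g, v ∉ Submodule.span (A I)ᵐᵒᵖ (Set.range g \ {v}))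
    {X Y : Set (Fin s → S I)} (hX : X ⊆ B I Δ) (hY : Y ⊆ ⋃ m, syzygyImage g Δ m)
    {b : Fin s → S I} (hb : b ∈ B I Δ) (h : b ∈ Submodule.span (Strunc I d) (X ∪ Y)) :
    b ∈ Submodule.span (Strunc I d) X := by
  obtain ⟨j, k, l, hl, rfl⟩ := hb
  -- Project to coordinate `j` and to places below `Δ_j`: an image has there only words of positive
  -- length starting at `Δ_j`, so it disappears.
  have key : ∀ y ∈ Submodule.span (Strunc I d) (X ∪ Y),
      Pi.single j (restrict hI (Set.Iio (Δ j)) (y j)) ∈ Submodule.span (Strunc I d) X := by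
    intro y hy
    induction hy using Submodule.span_induction with
    | mem y hy =>
      rcases hy with hy | hy
      · obtain ⟨j', k', l', hl', rfl⟩ := hX hy
        by_cases hj : j = j'
        · subst hj
          rw [Pi.single_eq_same, restrict_x_of_mem hI (Set.mem_Iio.2 hl')]
          exact Submodule.subset_span hy
        · rw [Pi.single_eq_of_ne hj, map_zero, Pi.single_zero]
          exact zero_mem _
      · obtain ⟨m, f, ⟨hfK, hfm⟩, rfl⟩ := Set.mem_iUnion.1 (hY hy)
        have h0 : restrict hI (Set.Iio (Δ j)) (iota I Δ f j) = 0 := by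
          rw [iota_apply]
          rcases syzygy_apply_eq_zero_or hinj hirr hfK hfm j with h | ⟨e, he, h⟩
          · rw [h, map_zero, map_zero]
          · exact restrict_up_eq_zero hI (l := Δ j) le_rfl (by omega)
              (Set.notMem_Iio.2 le_rfl) h
        rw [h0, Pi.single_zero]
        exact zero_mem _
    | zero =>
      rw [Pi.zero_apply, map_zero, Pi.single_zero]
      exact zero_mem _
    | add y z _ _ hy hz =>
      rw [Pi.add_apply, map_add, Pi.single_add]
      exact add_mem hy hz
    | smul a y _ hy =>
      have ha := restrict_mem_Strunc_of_mem hI (Set.Iio (Δ j)) a.2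
      have := Submodule.smul_mem _ (⟨_, ha⟩ : Strunc I d) hy
      rw [← Pi.single_smul] at this
      rw [Pi.smul_apply, Algebra.smul_def, map_mul]
      exact this
  have := key _ h
  rwa [Pi.single_eq_same, restrict_x_of_mem hI (Set.mem_Iio.2 hl)] at this

/-- A syzygy whose image is generated by `B` and by images of homogeneous vectors is generated
by the latter. -/
theorem mem_span_preimage (hI : IsGradedIdeal I) {H : Set (Fin s → A I)}
    (hH : ∀ h ∈ H, ∃ m, IsHomogeneousVec (compA I) Δ m h) {f : Fin s → A I}
    (hf : iota I Δ f ∈ Submodule.span (S I) (B I Δ ∪ iota I Δ '' H)) :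
    f ∈ Submodule.span (A I)ᵐᵒᵖ H := by
  have key : ∀ y ∈ Submodule.span (S I) (B I Δ ∪ iota I Δ '' H),
      (fun j => collapse hI (restrict hI (Set.Ici (Δ j)) (y j))) ∈
        Submodule.span (A I)ᵐᵒᵖ H := by
    intro y hy
    -- The map is additive but not `S`-linear, so scalar multiples of generators are treated as a
    -- whole.
    induction hy using Submodule.closure_induction with
    | zero =>
      simp only [Pi.zero_apply, map_zero]
      exact zero_mem _
    | add y z _ _ hy hz =>
      simp only [Pi.add_apply, map_add]
      exact add_mem hy hz
    | smul_mem a y hy =>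
      rcases hy with ⟨j, k, l, hl, rfl⟩ | ⟨h, hh, rfl⟩
      · have h0 : (fun j' => collapse hI (restrict hI (Set.Ici (Δ j'))
            ((a • Pi.single j (x I k l) : Fin s → S I) j'))) = 0 := by
          funext j'
          rw [Pi.smul_apply, smul_eq_mul, map_mul]
          by_cases hj : j' = j
          · subst hj
            rw [Pi.single_eq_same, restrict_x_of_notMem hI (Set.notMem_Ici.2 hl), mul_zero,
              map_zero]
            rfl
          · rw [Pi.single_eq_of_ne hj, map_zero, mul_zero, map_zero]
            rfl
        rw [h0]
        exact zero_mem _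
      · obtain ⟨m, hm⟩ := hH h hh
        -- As `h` has degree `m`, the words in all its coordinates end at the same place; hence one
        -- coefficient, read from `m` on, serves every `j`.
        have h0 : (fun j => collapse hI (restrict hI (Set.Ici (Δ j)) ((a • iota I Δ h) j))) =
            MulOpposite.op (collapse hI (restrict hI (Set.Ici m) a)) • h := by
          funext j
          rw [Pi.smul_apply, smul_eq_mul, map_mul, Pi.smul_apply, MulOpposite.smul_eq_mul_unop,
            MulOpposite.unop_op, iota_apply, mul_comm]
          rcases hm j with h0 | ⟨e, rfl, he⟩
          · simp [h0]
          · rw [restrict_up_of_subset hI (fun l hl _ => Set.mem_Ici.2 hl) he,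
              up_mul_restrict hI he, collapse_up_mul hI he]
        rw [h0]
        exact Submodule.smul_mem _ _ (Submodule.subset_span hh)
  have h := key _ hf
  rwa [show (fun j => collapse hI (restrict hI (Set.Ici (Δ j)) (iota I Δ f j))) = f from
    funext fun j => by
      rw [iota_apply, restrict_Ici_up, collapse_up]] at h

/-- Irredundance is inherited by the preimage under `ι`. -/
theorem iota_mem_span (hI : IsGradedIdeal I) {H : Set (Fin s → A I)}
    (hH : ∀ h ∈ H, ∃ m, IsHomogeneousVec (compA I) Δ m h)
    (hd : ∀ h ∈ H, ∀ j, iota I Δ h j ∈ Strunc I d) {f : Fin s → A I}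
    (hfd : ∀ j, iota I Δ f j ∈ Strunc I d) (hf : f ∈ Submodule.span (A I)ᵐᵒᵖ H) :
    iota I Δ f ∈ Submodule.span (Strunc I d) (iota I Δ '' H) := by
  have key : ∀ y ∈ Submodule.span (A I)ᵐᵒᵖ H,
      (fun j => restrict hI (Set.Iio d) (iota I Δ y j)) ∈
        Submodule.span (Strunc I d) (iota I Δ '' H) := by
    intro y hy
    induction hy using Submodule.closure_induction with
    | zero =>
      simp only [iota_apply, Pi.zero_apply, map_zero]
      exact zero_mem _
    | add y z _ _ hy hz =>
      simp only [iota_apply, Pi.add_apply, map_add] at hy hz ⊢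
      exact add_mem hy hz
    | smul_mem a y hy =>
      obtain ⟨m, hm⟩ := hH y hy
      -- Conversely, right multiplication by `a` becomes multiplication by `a` placed from `m` on,
      -- whatever the coordinate.
      have h0 : (fun j => restrict hI (Set.Iio d) (iota I Δ (a • y) j)) =
          (⟨_, restrict_mem_Strunc hI d (up I m a.unop)⟩ : Strunc I d) • iota I Δ y := by
        funext j
        have hy' := restrict_of_mem_Strunc hI (hd y hy j)
        rw [Pi.smul_apply, Algebra.smul_def, ← hy', iota_apply, iota_apply, Pi.smul_apply,
          MulOpposite.smul_eq_mul_unop]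
        rcases hm j with h0 | ⟨e, rfl, he⟩
        · simp [h0]
        · rw [← up_mul_up he, map_mul, mul_comm]
          rfl
      rw [h0]
      exact Submodule.smul_mem _ _ (Submodule.subset_span ⟨y, hy, rfl⟩)
  have h := key f hf
  rwa [show (fun j => restrict hI (Set.Iio d) (iota I Δ f j)) = iota I Δ f from
    funext fun j => restrict_of_mem_Strunc hI (hfd j)] at h

end Letterplace

end

/-! ### The proposition -/

theorem proposition9p1 {𝕂 : Type*} [Field 𝕂] (n : ℕ)
    (I : Ideal (Letterplace.F 𝕂 n)) [I.IsTwoSided] (hI : Letterplace.IsGradedIdeal I)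
    (r s d : ℕ)
    (M : Submodule (Letterplace.A I)ᵐᵒᵖ (Fin r → Letterplace.A I))
    (g : Fin s → Fin r → Letterplace.A I) (Δ : Fin s → ℕ)
    (hg_inj : Function.Injective g)
    (hg_deg : ∀ j, Letterplace.IsHomogeneousVec (Letterplace.compA I) (fun _ => 0) (Δ j) (g j))
    (hg_min : Letterplace.IsMinimalBasis
      (Letterplace.IsHomogeneousVec (Letterplace.compA I) (fun _ => 0)) M (Set.range g))
    (hM : Submodule.span (Letterplace.S I)
      (Letterplace.truncSet I (Letterplace.L I M) d) = Letterplace.L I M)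
    (H' : Set (Fin s → Letterplace.S I))
    (hH' : Letterplace.IsMinimalBasis
      (Letterplace.IsHomogeneousVec (Letterplace.compS I) Δ)
      (Letterplace.Ktrunc I (fun j => Letterplace.iota I (fun _ => 0) (g j)) d)
      (Letterplace.B I Δ ∪ H')) :
    (∃ H'' : Set (Fin s → Letterplace.S I),
      H'' ⊆ Set.range (Letterplace.iota I Δ) ∧
      Letterplace.IsMinimalBasis
        (Letterplace.IsHomogeneousVec (Letterplace.compS I) Δ)
        (Letterplace.Ktrunc I (fun j => Letterplace.iota I (fun _ => 0) (g j)) d)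
        (Letterplace.B I Δ ∪ H'')) ∧
    (H' ⊆ Set.range (Letterplace.iota I Δ) →
      Letterplace.IsMinimalBasisUpTo
        (Letterplace.IsHomogeneousVec (Letterplace.compA I) Δ)
        (Letterplace.K I g) d (Letterplace.iota I Δ ⁻¹' H')) := by
  open Letterplace in
  have hg : ∀ j i, g j i ∈ compA I (Δ j) := fun j => (hg_deg j).apply_mem_compA
  have hirr := hg_min.irredundant
  have hsub : B I Δ ∪ H' ⊆ Ktrunc I (fun j => iota I (fun _ => 0) (g j)) d := by
    rw [← hH'.span_eq]
    exact Submodule.subset_span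
  -- The given basis puts `B` inside `S(d)^s` and excludes zero from it, since zero is always
  -- redundant.
  have hΔ : ∀ j, Δ j ≤ d := degree_le hI hirr hg (fun b hb => (hsub (Or.inl hb)).2) (by
    rintro b hb rfl
    exact hH'.irredundant 0 (Or.inl hb) (zero_mem _))
  constructor
  · have hspan : Submodule.span (Strunc I d) (B I Δ ∪ ⋃ m ≤ d, syzygyImage g Δ m) =
        Ktrunc I (fun j => iota I (fun _ => 0) (g j)) d := by
      refine le_antisymm (Submodule.span_le.2 (Set.union_subset
        (Set.subset_union_left.trans hsub) (Set.iUnion₂_subset fun m hm => ?_)))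
        (Ktrunc_le_span hI hg_inj hirr hg hΔ)
      exact syzygyImage_subset_Ktrunc hI hg hm
    obtain ⟨H'', hsubset, hspan'', hirr''⟩ := exists_subset_irredundant (Ktrunc_fg _ d) hspan
    have hsyz : H'' ⊆ ⋃ m, syzygyImage g Δ m :=
      hsubset.trans (Set.iUnion₂_subset fun m _ => Set.subset_iUnion (syzygyImage g Δ) m)
    refine ⟨H'', fun y hy => ?_, ⟨?_, hspan'', ?_⟩⟩
    · obtain ⟨m, f, _, rfl⟩ := Set.mem_iUnion.1 (hsyz hy)
      exact ⟨f, rfl⟩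
    · rintro y (hy | hy)
      · exact hH'.homogeneous y (Or.inl hy)
      · obtain ⟨m, f, hf, rfl⟩ := Set.mem_iUnion.1 (hsyz hy)
        exact ⟨m, iota_homogeneous hf.2⟩
    · rintro y (hy | hy) h
      -- A relation for an element of `B` projects to one inside `B` alone, which the given basis
      -- forbids.
      · refine hH'.irredundant y (Or.inl hy) (Submodule.span_mono
          (Set.sdiff_subset_sdiff_left Set.subset_union_left)
          (B_irredundant (X := B I Δ \ {y}) hI hg_inj hirr Set.sdiff_subset hsyz hy
            (Submodule.span_mono ?_ h)))
        rintro z ⟨hz | hz, hzy⟩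
        · exact Or.inl ⟨hz, hzy⟩
        · exact Or.inr hz
      · exact hirr'' y hy h
  · intro hrange
    have himage : iota I Δ '' (iota I Δ ⁻¹' H') = H' := Set.image_preimage_eq_of_subset hrange
    have hKt : ∀ h ∈ iota I Δ ⁻¹' H',
        iota I Δ h ∈ Ktrunc I (fun j => iota I (fun _ => 0) (g j)) d :=
      fun h hh => hsub (Or.inr hh)
    have hK : ∀ h ∈ iota I Δ ⁻¹' H', h ∈ K I g :=
      fun h hh => (iota_mem_K'_iff hI hg).1 (hKt h hh).1
    have hhom : ∀ h ∈ iota I Δ ⁻¹' H', ∃ m, IsHomogeneousVec (compA I) Δ m h := by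
      intro h hh
      obtain ⟨m, hm⟩ := hH'.homogeneous _ (Or.inr hh)
      exact ⟨m, homogeneous_of_iota hI hm⟩
    refine ⟨hK, fun h hh => ?_, fun e he f hf hfe => ?_, fun h hh hmem => ?_⟩
    · obtain ⟨m, hm⟩ := hhom h hh
      refine ⟨m, ?_, hm⟩
      by_contra! hlt
      refine hH'.irredundant _ (Or.inr hh) ?_
      -- A component of degree beyond `d` would need a letter at the place `m - 1 ≥ d`, absent from
      -- `S(d)`.
      have h0 : iota I Δ h = 0 := by
        funext j
        rw [Pi.zero_apply, ← restrict_of_mem_Strunc hI ((hKt h hh).2 j), iota_apply]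
        rcases syzygy_apply_eq_zero_or hg_inj hirr (hK h hh) hm j with h0 | ⟨e, he, h0⟩
        · rw [h0, map_zero, map_zero]
        · exact restrict_up_eq_zero hI (l := Δ j + e) (by omega) (by omega)
            (Set.notMem_Iio.2 (by omega)) h0
      rw [h0]
      exact zero_mem _
    · refine mem_span_preimage hI hhom ?_
      rw [himage]
      -- Coefficients may be enlarged from `S(d)` to `S`, as `collapse` works over all of `S`.
      refine Submodule.span_le_restrictScalars (Strunc I d) (S I) _ ?_
      rw [hH'.span_eq]
      exact syzygyImage_subset_Ktrunc hI hg he ⟨f, ⟨hf, hfe⟩, rfl⟩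
    · refine hH'.irredundant _ (Or.inr hh) (Submodule.span_mono ?_
        (iota_mem_span hI (fun h hh => hhom h hh.1) (fun h hh => (hKt h hh.1).2)
          (hKt h hh).2 hmem))
      rintro _ ⟨h', ⟨hh', hne⟩, rfl⟩
      exact ⟨Or.inr hh', fun heq => hne (iota_injective hI heq)⟩
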